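/- \textbf{Setting.} A strongly regular D-GLDPC ensemble sequence $\{\mathcal M_n\}$ is given by integers $k,q,s$ as follows. There are $n$ variable nodes (VNs), each a binary $(q,k)$ linear code with a rank-$k$ generator matrix $\mathbf G$ mapping local input words $a\in\mathbb F_2^k$ to $a\mathbf G$, and all with the same input-output weight enumerating function $B(x,y)=\sum_{u,v}B_{u,v}x^uy^v$, where $B_{u,v}$ is the number of weight-$u$ input words producing weight-$v$ local codewords. There are $nq/s$ check nodes (CNs) ($n$ is such that $s\mid nq$), each a nonzero binary linear code of length $s$, and all with the same weight enumerating function $A(z)=\sum_u A_uz^u$. A member of $\mathcal M_n$ is a bijection, chosen uniformly at random, between the $nq$ VN sockets and the $nq$ CN sockets. Its codewords are the words in $(\mathbb F_2^{k})^n$ such that, when each VN encodes its $k$ bits, every CN receives a word of its local code; $N_w$ is the number of codewords of weight $w$. Put $\int\lambda=\int_0^1x^{q-1}dx=1/q$, $\int\rho=\int_0^1x^{s-1}dx=1/s$, and $h(p)=-p\log p-(1-p)\log(1-p)$ with $h(0)=h(1)=0$. The growth rate is $G(\alpha)=\lim_{n\to\infty}\frac1n\log\mathbb E_{\mathcal M_n}[N_{\alpha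 n}]$. The limit is over $n\to\infty$ with $s\mid nq$ and integer weights $w$ with $w/n\to\alpha$ (in particular $w=\alpha n$) for which the expectation is nonzero; $G(\alpha)=-\infty$ means that the expectation is zero for all such $n,w$ with $n$ large enough and $w/n$ close enough to $\alpha$. For $1\le i\le k$ let $U_i$ and $V_i$ be the smallest and the largest $j$ with $B_{i,j}>0$, and let $$m(\alpha)=\min_\omega\sum_{i=1}^kU_i\omega_i,\qquad M(\alpha)=\max_\omega\sum_{i=1}^kV_i\omega_i$$ over all $\omega\in\mathbb R^k$ with $\omega_i\ge0$, $\sum_i\omega_i\le1$, $\sum_i i\,\omega_i=\alpha$. Let $\bar\beta=(\int\rho/\int\lambda)\deg A$. \textbf{Statement.} Let $0<\alpha<k$. Consider the saddle-point equations $$\frac{\partial_xB(x_0,y_0)}{B(x_0,y_0)}x_0=\alpha,\qquad \frac{\partial_yB(x_0,y_0)}{B(x_0,y_0)}y_0=\beta,\qquad \frac{A'(z_0)}{A(z_0)}z_0=\beta\,\frac{\int\lambda}{\int\rho}.$$ (a) For $m(\alpha)<\beta<M(\alpha)$ the first two have a unique positive real solution $(x_0,y_0)$. If $m(\alpha)=M(\alpha)=\beta$,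 they have a positive solution. For $0<\beta<\bar\beta$ the third has a unique positive real solution $z_0$. (b) There are functions $X$, continuous on $[m(\alpha),M(\alpha)]$, and $Y$, continuous on $(0,\bar\beta]$, with $$X(\beta)=\log\frac{B(x_0,y_0)}{x_0^\alpha y_0^\beta},\qquad Y(\beta)=\log\frac{A(z_0)^{\int\rho/\int\lambda}}{z_0^\beta}-\frac{h(\beta\int\lambda)}{\int\lambda}$$ for every positive solution $(x_0,y_0)$, respectively $z_0$, of the equations at $\beta$; by (a), these functions are uniquely determined. If $[m(\alpha),M(\alpha)]\cap(0,\bar\beta]\neq\emptyset$, the growth rate exists and $$G(\alpha)=\max_{m(\alpha)\le\beta\le M(\alpha),\ 0<\beta\le\bar\beta}\bigl[X(\beta)+Y(\beta)\bigr].$$ In this case there are pairs $(n,w)$ with $n$ arbitrarily large, $w/n$ arbitrarily close to $\alpha$ and $\mathbb E_{\mathcal M_n}[N_w]>0$, and for rational $\alpha$ there are infinitely many $n$ for which $w=\alpha n$ is such a weight. (c) If $[m(\alpha),M(\alpha)]\cap(0,\bar\beta]=\emptyset$, then $G(\alpha)=-\infty$. -/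

import Mathlib

noncomputable section

namespace DGLDPC

/-- Number of weight-`u` codewords of a check node (CN) with local code `C`. -/
def wefCoeff {s : ℕ} (C : Submodule (ZMod 2) (Fin s → ZMod 2)) (u : ℕ) : ℕ :=
  Nat.card {c : Fin s → ZMod 2 // c ∈ C ∧ hammingNorm c = u}

/-- Number of weight-`v` local codewords generated by weight-`u` local input words, for a variable
node (VN) with generator matrix `G`. -/
def ioCoeff {k q : ℕ} (G : Matrix (Fin k) (Fin q) (ZMod 2)) (u v : ℕ) : ℕ :=
  Nat.card {a : Fin k → ZMod 2 // hammingNorm a = u ∧ hammingNorm (Matrix.vecMul a G) = v}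

/-- The weight enumerating function `A(z)` of a CN. -/
def wef {s : ℕ} (C : Submodule (ZMod 2) (Fin s → ZMod 2)) (z : ℝ) : ℝ :=
  ∑ u ∈ Finset.range (s + 1), (wefCoeff C u : ℝ) * z ^ u

/-- The input-output weight enumerating function `B(x, y)` of a VN. -/
def ioWef {k q : ℕ} (G : Matrix (Fin k) (Fin q) (ZMod 2)) (x y : ℝ) : ℝ :=
  ∑ u ∈ Finset.range (k + 1), ∑ v ∈ Finset.range (q + 1), (ioCoeff G u v : ℝ) * x ^ u * y ^ v

/-- A strongly regular D-GLDPC ensemble sequence. For every `n` there are `n` VNs, each a `(q, k)`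
linear code with a generator matrix, and `n * q / s` CNs, each a linear code of length `s`. All VNs
have the type (IO-WEF) of the generator matrix `vnRep`, and all CNs have the type (WEF) of the
code `cnRep`; nodes of the same type need not be equal. -/
structure StronglyRegularEnsemble (k q s : ℕ) where
  vnRep : Matrix (Fin k) (Fin q) (ZMod 2)
  cnRep : Submodule (ZMod 2) (Fin s → ZMod 2)
  vnRep_linearIndependent : LinearIndependent (ZMod 2) vnRep.row
  cnRep_ne_bot : cnRep ≠ ⊥
  vn : (n : ℕ) → Fin n → Matrix (Fin k) (Fin q) (ZMod 2)
  cn : (n : ℕ) → Fin (n * q / s) → Submodule (ZMod 2) (Fin s → ZMod 2)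
  vn_type : ∀ n j u v, ioCoeff (vn n j) u v = ioCoeff vnRep u v
  cn_type : ∀ n i u, wefCoeff (cn n i) u = wefCoeff cnRep u

namespace StronglyRegularEnsemble

variable {k q s : ℕ} (𝓜 : StronglyRegularEnsemble k q s)

/-- A member of the ensemble with `n` VNs: a bijection from the VN sockets to the CN sockets,
i.e. a permutation of the edges. -/
abbrev Member (_ : StronglyRegularEnsemble k q s) (n : ℕ) : Type :=
  (Fin n × Fin q) ≃ (Fin (n * q / s) × Fin s)

/-- `a` (the `k` code bits of each of the `n` VNs) is a codeword of the code given by `π`: every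
VN encodes its bits, and every CN receives a word of its local code. -/
def IsCodeword (n : ℕ) (π : 𝓜.Member n) (a : Fin n → Fin k → ZMod 2) : Prop :=
  ∀ i : Fin (n * q / s),
    (fun e : Fin s =>
      Matrix.vecMul (a (π.symm (i, e)).1) (𝓜.vn n (π.symm (i, e)).1) (π.symm (i, e)).2) ∈ 𝓜.cn n i

/-- The number `N_w` of codewords of weight `w` of the code given by `π`. -/
def numCodewords (n : ℕ) (π : 𝓜.Member n) (w : ℕ) : ℕ :=
  Nat.card {a : Fin n → Fin k → ZMod 2 // 𝓜.IsCodeword n π a ∧ ∑ j, hammingNorm (a j) = w}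

/-- The expectation of `N_w` over the ensemble with `n` VNs (uniform edge permutation). It is used
only where `s ∣ n * q`, i.e. where the ensemble with `n` VNs exists. -/
def expNumCodewords (n w : ℕ) : ℝ :=
  (∑ π : 𝓜.Member n, (𝓜.numCodewords n π w : ℝ)) / (Fintype.card (𝓜.Member n) : ℝ)

/-- Pairs `(n, w)` such that the ensemble with `n` VNs exists, `n → ∞` and `w / n → α`. -/
def weightFilter (_ : StronglyRegularEnsemble k q s) (α : ℝ) : Filter (ℕ × ℕ) :=
  Filter.comap Prod.fst Filter.atTop ⊓
    Filter.comap (fun p : ℕ × ℕ => (p.2 : ℝ) / (p.1 : ℝ)) (nhds α) ⊓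
    Filter.principal {p | s ∣ p.1 * q}

/-- `G(α) = g`, where `G(α) = lim (1/n) log E[N_{αn}]`. The limit runs over pairs `(n, w)` with
`w / n → α` (in particular over `w = αn`) for which the expectation does not vanish; such pairs
occur with arbitrarily large `n`, and for rational `α` they occur with `w = αn` exactly. -/
def HasGrowthRate (α g : ℝ) : Prop :=
  (∃ᶠ p in 𝓜.weightFilter α, 0 < 𝓜.expNumCodewords p.1 p.2) ∧
  ((∃ r : ℚ, (r : ℝ) = α) → ∃ᶠ n : ℕ in Filter.atTop, s ∣ n * q ∧
    ∃ w : ℕ, (w : ℝ) = α * n ∧ 0 < 𝓜.expNumCodewords n w) ∧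
  Filter.Tendsto (fun p : ℕ × ℕ => 1 / (p.1 : ℝ) * Real.log (𝓜.expNumCodewords p.1 p.2))
    (𝓜.weightFilter α ⊓ Filter.principal {p | 0 < 𝓜.expNumCodewords p.1 p.2}) (nhds g)

/-- `∫ λ`, where `λ(x) = x ^ (q - 1)`. -/
def intLambda (_ : StronglyRegularEnsemble k q s) : ℝ := ∫ x in (0 : ℝ)..1, x ^ (q - 1)

/-- `∫ ρ`, where `ρ(x) = x ^ (s - 1)`. -/
def intRho (_ : StronglyRegularEnsemble k q s) : ℝ := ∫ x in (0 : ℝ)..1, x ^ (s - 1)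

/-- The function `B(x, y)` of the ensemble. -/
def B (x y : ℝ) : ℝ := ioWef 𝓜.vnRep x y

/-- The function `A(z)` of the ensemble. -/
def A (z : ℝ) : ℝ := wef 𝓜.cnRep z

/-- Minimum local codeword weight for local input weight `i`. -/
def U (i : ℕ) : ℕ := sInf {j | 0 < ioCoeff 𝓜.vnRep i j}

/-- Maximum local codeword weight for local input weight `i`. -/
def V (i : ℕ) : ℕ := sSup {j | 0 < ioCoeff 𝓜.vnRep i j}

/-- Vectors `(ω_1, …, ω_k)` with `ω_i ≥ 0`, `∑ ω_i ≤ 1` and `∑ i ω_i = α`; the entry `ω_{i+1}` is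
stored at index `i : Fin k`. -/
def feasible (_ : StronglyRegularEnsemble k q s) (α : ℝ) : Set (Fin k → ℝ) :=
  {ω | (∀ i, 0 ≤ ω i) ∧ ∑ i, ω i ≤ 1 ∧ ∑ i : Fin k, ((i : ℝ) + 1) * ω i = α}

/-- `m(α)`: the minimum of `∑ U_i ω_i`. -/
def lower (α : ℝ) : ℝ :=
  sInf ((fun ω : Fin k → ℝ => ∑ i : Fin k, (𝓜.U (i + 1) : ℝ) * ω i) '' 𝓜.feasible α)

/-- `M(α)`: the maximum of `∑ V_i ω_i`. -/
def upper (α : ℝ) : ℝ :=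
  sSup ((fun ω : Fin k → ℝ => ∑ i : Fin k, (𝓜.V (i + 1) : ℝ) * ω i) '' 𝓜.feasible α)

/-- The largest weight of a CN codeword, which is the degree of `A`. -/
def cnMaxWeight : ℕ := sSup {u | 0 < wefCoeff 𝓜.cnRep u}

/-- `(x, y)` is a positive solution of the two VN saddle-point equations at `(α, β)`. -/
def IsVNSaddle (α β x y : ℝ) : Prop :=
  0 < x ∧ 0 < y ∧
  deriv (fun t => 𝓜.B t y) x / 𝓜.B x y * x = α ∧
  deriv (fun t => 𝓜.B x t) y / 𝓜.B x y * y = β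

/-- `z` is a positive solution of the CN saddle-point equation at `β`. -/
def IsCNSaddle (β z : ℝ) : Prop :=
  0 < z ∧ deriv 𝓜.A z / 𝓜.A z * z = β * (𝓜.intLambda / 𝓜.intRho)

/-- `X(β)` is the VN term of the growth rate at `α`: a continuous function on `[m(α), M(α)]` equal
to `log (B(x₀, y₀) / (x₀^α y₀^β))` whenever `(x₀, y₀)` solves the saddle-point equations. -/
def IsVNTerm (α : ℝ) (X : ℝ → ℝ) : Prop :=
  ContinuousOn X (Set.Icc (𝓜.lower α) (𝓜.upper α)) ∧
  ∀ β ∈ Set.Icc (𝓜.lower α) (𝓜.upper α), ∀ x₀ y₀, 𝓜.IsVNSaddle α β x₀ y₀ →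
    X β = Real.log (𝓜.B x₀ y₀ / (x₀ ^ α * y₀ ^ β))

/-- The `β > 0` for which the right-hand side of the CN saddle-point equation is at most the degree
of `A`. For larger `β` no CN words of the required weight exist. -/
def cnRange : Set ℝ := {β | 0 < β ∧ β * (𝓜.intLambda / 𝓜.intRho) ≤ 𝓜.cnMaxWeight}

/-- `Y(β)` is the CN term of the growth rate: a continuous function on the range above equal to
`log (A(z₀)^(∫ρ/∫λ) / z₀^β) - h(β ∫λ) / ∫λ` whenever `z₀` solves the saddle-point equation. -/
def IsCNTerm (Y : ℝ → ℝ) : Prop :=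
  ContinuousOn Y 𝓜.cnRange ∧
  ∀ β ∈ 𝓜.cnRange, ∀ z₀, 𝓜.IsCNSaddle β z₀ →
    Y β = Real.log (𝓜.A z₀ ^ (𝓜.intRho / 𝓜.intLambda) / z₀ ^ β)
      - Real.binEntropy (β * 𝓜.intLambda) / 𝓜.intLambda

end StronglyRegularEnsemble

end DGLDPC

end

/-!
A codeword has a type: how often each input word occurs at the VNs and each local codeword at the
CNs, where the number of ones carried by the edges is the same on both sides. Averaging over the
permutation of the sockets, the expected number of codewords of a given type is a product of two
multinomial coefficients divided by one binomial coefficient. There are only polynomially many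
types, so exponentially the sum over all types is its largest term, and the growth rate is the
maximum of the resulting entropy exponent over the polytope of limiting types. The lower bound needs
integral types near a given point of this polytope: coordinates that vanish must stay zero, and the
linear constraints hold exactly because bounded integral corrections exist.

Fixing the number `β` of ones on the edges per VN, the exponent splits into a VN and a CN entropy
maximization, each over a slice of a compact convex set, and the maxima are continuous in `β`. By
Gibbs' inequality a maximizer is an exponentially tilted uniform law, and the saddle-point equations
say exactly that the tilted law has the prescribed means. Their solutions are the critical points of
a sum of exponentials of linear forms, which is coercive and strictly convex when the prescribed
means are interior.
-/

namespace DGLDPC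

open Real Finset Filter Topology Asymptotics
open scoped Matrix

/-! ### Multinomial and binomial coefficients -/

lemma mul_log_sub_le_log_factorial (n : ℕ) : n * log n - n ≤ log (n.factorial : ℝ) := by
  rcases eq_or_ne n 0 with rfl | hn
  · simp
  have hπ : 0 ≤ log (2 * π) := log_nonneg (by linarith [two_le_pi])
  linarith [Stirling.le_log_factorial_stirling hn, log_natCast_nonneg n]

lemma log_factorial_le (n : ℕ) :
    log (n.factorial : ℝ) ≤ n * log n - n + (1 + log (n + 1)) := by
  rcases n with _ | n
  · simp
  have hanti : log (Stirling.stirlingSeq (n + 1)) ≤ log (Stirling.stirlingSeq 1) :=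
    Stirling.log_stirlingSeq'_antitone n.zero_le
  have hpos : (0 : ℝ) < (n + 1 : ℕ) := by positivity
  rw [Stirling.log_stirlingSeq_formula, Stirling.stirlingSeq_one, log_div (exp_ne_zero 1) (by simp),
    log_div hpos.ne' (exp_ne_zero 1), log_sqrt zero_le_two, log_mul two_ne_zero hpos.ne', log_exp]
    at hanti
  have hmono : log (n + 1 : ℕ) ≤ log ((n + 1 : ℕ) + 1) := log_le_log hpos (by linarith)
  linarith [log_natCast_nonneg (n + 1)]

/-- The exponential growth rate of multinomial coefficients: `n` times the entropy of the
distribution `N / n`, where `n = ∑ i, N i`. This form is homogeneous and needs no division. -/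
noncomputable def multinomialExponent {S : Type*} [Fintype S] (N : S → ℝ) : ℝ :=
  ∑ i, negMulLog (N i) - negMulLog (∑ i, N i)

section Multinomial

variable {S : Type*} [Fintype S]

lemma multinomialExponent_smul (c : ℝ) (N : S → ℝ) :
    multinomialExponent (c • N) = c * multinomialExponent N := by
  simp only [multinomialExponent, Pi.smul_apply, smul_eq_mul, negMulLog_mul, sum_add_distrib,
    ← mul_sum, ← sum_mul]
  ring

lemma continuous_multinomialExponent : Continuous (multinomialExponent (S := S)) := by
  unfold multinomialExponent
  fun_prop

lemma multinomialExponent_eq_sub (N : S → ℝ) :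
    multinomialExponent N = (∑ i, N i) * log (∑ i, N i) - ∑ i, N i * log (N i) := by
  simp only [multinomialExponent, negMulLog, neg_mul, sum_neg_distrib]
  ring

lemma multinomial_mul_prod_pow_self_le (N : S → ℕ) :
    Nat.multinomial univ N * ∏ i, N i ^ N i ≤ (∑ i, N i) ^ ∑ i, N i := by
  classical
  rw [sum_pow_eq_sum_piAntidiag]
  exact single_le_sum (f := fun k ↦ Nat.multinomial univ k * ∏ i, N i ^ k i)
    (fun _ _ ↦ Nat.zero_le _) (mem_piAntidiag.2 ⟨rfl, fun i _ ↦ mem_univ i⟩)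

lemma log_multinomial_le (N : S → ℕ) :
    log (Nat.multinomial univ N) ≤ multinomialExponent fun i ↦ (N i : ℝ) := by
  have hpow (i : S) : (0 : ℝ) < (N i : ℝ) ^ N i := by exact_mod_cast Nat.pow_self_pos
  have hmult : (0 : ℝ) < Nat.multinomial univ N := by exact_mod_cast Nat.multinomial_pos univ N
  have hle : (Nat.multinomial univ N : ℝ) * ∏ i, (N i : ℝ) ^ N i ≤
      (∑ i, (N i : ℝ)) ^ ∑ i, N i := by
    exact_mod_cast multinomial_mul_prod_pow_self_le N
  have hlog := log_le_log (mul_pos hmult (prod_pos fun i _ ↦ hpow i)) hle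
  rw [log_mul hmult.ne' (prod_pos fun i _ ↦ hpow i).ne', log_prod fun i _ ↦ (hpow i).ne',
    log_pow, Nat.cast_sum] at hlog
  simp only [log_pow] at hlog
  rw [multinomialExponent_eq_sub]
  linarith

lemma le_log_multinomial (N : S → ℕ) :
    multinomialExponent (fun i ↦ (N i : ℝ)) -
        Fintype.card S * (1 + log ((∑ i, N i : ℕ) + 1)) ≤
      log (Nat.multinomial univ N) := by
  have hfact (i : S) : ((N i).factorial : ℝ) ≠ 0 := by exact_mod_cast (N i).factorial_ne_zero
  have hmult : (Nat.multinomial univ N : ℝ) ≠ 0 := by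
    exact_mod_cast (Nat.multinomial_pos univ N).ne'
  have hspec : (∏ i, ((N i).factorial : ℝ)) * Nat.multinomial univ N = (∑ i, N i).factorial := by
    exact_mod_cast Nat.multinomial_spec univ N
  have hlog := congrArg log hspec
  rw [log_mul (prod_ne_zero_iff.2 fun i _ ↦ hfact i) hmult, log_prod fun i _ ↦ hfact i] at hlog
  have hterm (i : S) : log ((N i).factorial : ℝ) ≤
      (N i * log (N i) - N i) + (1 + log ((∑ i, N i : ℕ) + 1)) := by
    have hNi : (N i : ℝ) ≤ (∑ i, N i : ℕ) := by
      exact_mod_cast single_le_sum (fun _ _ ↦ Nat.zero_le _) (mem_univ i)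
    linarith [log_factorial_le (N i),
      log_le_log (by positivity) (by linarith : (N i : ℝ) + 1 ≤ (∑ i, N i : ℕ) + 1)]
  have hsum := sum_le_sum fun i (_ : i ∈ univ) ↦ hterm i
  rw [sum_add_distrib, sum_sub_distrib, sum_const, card_univ, nsmul_eq_mul] at hsum
  have hlower := mul_log_sub_le_log_factorial (∑ i, N i)
  rw [multinomialExponent_eq_sub]
  push_cast at *
  linarith

end Multinomial

lemma multinomialExponent_pair {a : ℝ} (ha : a ≠ 0) (b : ℝ) :
    multinomialExponent ![b, a - b] = a * binEntropy (b / a) := by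
  have hsmul : ![b, a - b] = a • ![b / a, 1 - b / a] := by
    ext i
    fin_cases i <;> simp [mul_sub, mul_div_cancel₀ _ ha]
  rw [hsmul, multinomialExponent_smul, binEntropy_eq_negMulLog_add_negMulLog_one_sub]
  simp [multinomialExponent]

lemma choose_eq_multinomial {n e : ℕ} (he : e ≤ n) :
    n.choose e = Nat.multinomial univ ![e, n - e] := by
  rw [Nat.multinomial_univ_two, Nat.add_sub_cancel' he, Nat.choose_eq_factorial_div_factorial he]

lemma multinomialExponent_natCast_pair {n e : ℕ} (he : e ≤ n) :
    multinomialExponent (fun i ↦ ((![e, n - e] : Fin 2 → ℕ) i : ℝ)) =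
      n * binEntropy (e / n) := by
  rcases eq_or_ne n 0 with rfl | hn
  · simp [multinomialExponent, Nat.le_zero.1 he]
  rw [← multinomialExponent_pair (by exact_mod_cast hn)]
  congr 1
  ext i
  fin_cases i <;> simp [he]

lemma log_choose_le {n e : ℕ} (he : e ≤ n) : log (n.choose e) ≤ n * binEntropy (e / n) := by
  rw [choose_eq_multinomial he, ← multinomialExponent_natCast_pair he]
  exact log_multinomial_le _

lemma le_log_choose {n e : ℕ} (he : e ≤ n) :
    n * binEntropy (e / n) - 2 * (1 + log (n + 1)) ≤ log (n.choose e) := by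
  have h := le_log_multinomial ![e, n - e]
  simpa [multinomialExponent_natCast_pair he, ← choose_eq_multinomial he, he] using h

/-! ### Types of words -/

lemma exists_equiv_comp_eq_of_card_fiber_eq {ι κ S : Type*} [Finite ι] [Finite κ]
    (f : ι → S) (g : κ → S) (h : ∀ i, Nat.card {j // f j = i} = Nat.card {j // g j = i}) :
    ∃ τ : ι ≃ κ, g ∘ τ = f :=
  ⟨Equiv.ofFiberEquiv fun i ↦ (Finite.card_eq.1 (h i)).some,
    funext fun j ↦ Equiv.ofFiberEquiv_map _ j⟩

section TypeClass

variable {ι κ S : Type*} [Fintype ι] [Fintype κ] [DecidableEq S]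

/-- The type of a word, in the sense of the method of types: the number of occurrences of each
letter. -/
def wordType (f : ι → S) (i : S) : ℕ := #{j | f j = i}

lemma card_fiber_eq_wordType (f : ι → S) (i : S) : Fintype.card {j // f j = i} = wordType f i :=
  Fintype.card_subtype _

lemma wordType_le_card (f : ι → S) (i : S) : wordType f i ≤ Fintype.card ι :=
  card_le_univ _

lemma wordType_comp_equiv (f : κ → S) (τ : ι ≃ κ) : wordType (f ∘ τ) = wordType f := by
  funext i
  rw [← card_fiber_eq_wordType, ← card_fiber_eq_wordType]
  exact Fintype.card_congr (τ.subtypeEquiv fun _ ↦ Iff.rfl)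

lemma exists_equiv_comp_eq_of_wordType_eq {f : ι → S} {g : κ → S} (h : wordType f = wordType g) :
    ∃ τ : ι ≃ κ, g ∘ τ = f :=
  exists_equiv_comp_eq_of_card_fiber_eq f g fun i ↦ by
    rw [Nat.card_eq_fintype_card, Nat.card_eq_fintype_card, card_fiber_eq_wordType,
      card_fiber_eq_wordType, h]

variable [Fintype S]

lemma sum_comp_eq_sum_wordType_mul (f : ι → S) (u : S → ℕ) :
    ∑ j, u (f j) = ∑ i, wordType f i * u i := by
  rw [← sum_fiberwise univ f]
  refine sum_congr rfl fun i _ ↦ ?_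
  rw [sum_congr rfl fun j hj ↦ congrArg u (mem_filter.1 hj).2, sum_const, smul_eq_mul, wordType]

lemma sum_wordType (f : ι → S) : ∑ i, wordType f i = Fintype.card ι := by
  simpa using (sum_comp_eq_sum_wordType_mul f 1).symm

lemma exists_wordType_eq {N : S → ℕ} (h : ∑ i, N i = Fintype.card ι) :
    ∃ f : ι → S, wordType f = N := by
  let e : ι ≃ Σ i, Fin (N i) := Fintype.equivOfCardEq (by simp [h])
  refine ⟨Sigma.fst ∘ e, ?_⟩
  rw [wordType_comp_equiv]
  funext i
  rw [← card_fiber_eq_wordType, Fintype.card_congr (Equiv.sigmaSubtype i), Fintype.card_fin]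

variable [DecidableEq ι]

lemma card_equiv_comp_eq [DecidableEq κ] {f : ι → S} {g : κ → S} (h : wordType f = wordType g) :
    #{τ : ι ≃ κ | g ∘ τ = f} = ∏ i, (wordType f i).factorial := by
  obtain ⟨τ₀, rfl⟩ := exists_equiv_comp_eq_of_wordType_eq h
  let e : {σ : Equiv.Perm ι // (g ∘ τ₀) ∘ σ = g ∘ τ₀} ≃ {τ : ι ≃ κ // g ∘ τ = g ∘ τ₀} :=
    (Equiv.equivCongr (Equiv.refl ι) τ₀).subtypeEquiv fun _ ↦ Iff.rfl
  rw [← Fintype.card_subtype, ← Fintype.card_congr e, DomMulAct.stabilizer_card]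
  simp only [card_fiber_eq_wordType]

lemma card_wordType_eq {N : S → ℕ} (h : ∑ i, N i = Fintype.card ι) :
    #{f : ι → S | wordType f = N} = Nat.multinomial univ N := by
  obtain ⟨f₀, rfl⟩ := exists_wordType_eq h
  have horbit : (Fintype.card ι).factorial =
      ∑ f : ι → S with wordType f = wordType f₀, #{τ : Equiv.Perm ι | f₀ ∘ τ = f} := by
    rw [← Fintype.card_perm, ← card_univ]
    exact card_eq_sum_card_fiberwise fun τ _ ↦ by simp [wordType_comp_equiv]
  have hstab : ∀ f ∈ ({f : ι → S | wordType f = wordType f₀} : Finset _),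
      #{τ : Equiv.Perm ι | f₀ ∘ τ = f} = ∏ i, (wordType f₀ i).factorial := fun f hf ↦ by
    rw [card_equiv_comp_eq (mem_filter.1 hf).2, (mem_filter.1 hf).2]
  rw [sum_congr rfl hstab, sum_const, smul_eq_mul, ← h, ← Nat.multinomial_spec, mul_comm] at horbit
  exact (Nat.eq_of_mul_eq_mul_right (prod_pos fun i _ ↦ Nat.factorial_pos _) horbit).symm

end TypeClass

/-! ### Exponential tilting -/

section ExponentialFamily

variable {E S : Type*} [NormedAddCommGroup E] [NormedSpace ℝ E] [Fintype S] {w : S → E →L[ℝ] ℝ}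

lemma exists_pos_mul_norm_le_sum_exp [FiniteDimensional ℝ E] (hw : ∀ d ≠ 0, ∃ a, 0 < w a d) :
    ∃ δ > 0, ∀ θ, δ * ‖θ‖ ≤ ∑ a, exp (w a θ) := by
  have hproper : ProperSpace E := FiniteDimensional.proper ℝ E
  have hcont : Continuous fun d ↦ ∑ a, max (w a d) 0 := by fun_prop
  obtain ⟨δ, hδ, hmin⟩ : ∃ δ, 0 < δ ∧ ∀ d ∈ Metric.sphere (0 : E) 1, δ ≤ ∑ a, max (w a d) 0 := by
    refine (isCompact_sphere 0 1).exists_forall_le' hcont.continuousOn fun d hd ↦ ?_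
    obtain ⟨a, ha⟩ := hw d (ne_zero_of_mem_unit_sphere ⟨d, hd⟩)
    exact sum_pos' (fun _ _ ↦ le_max_right _ _) ⟨a, mem_univ a, lt_max_of_lt_left ha⟩
  refine ⟨δ, hδ, fun θ ↦ ?_⟩
  rcases eq_or_ne θ 0 with rfl | hθ
  · simp
  have hnorm : 0 < ‖θ‖ := norm_pos_iff.2 hθ
  calc δ * ‖θ‖
      ≤ (∑ a, max (w a (‖θ‖⁻¹ • θ)) 0) * ‖θ‖ := by
        gcongr
        exact hmin _ (by simp [norm_smul, hnorm.ne'])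
    _ = ∑ a, max (w a θ) 0 := by
        rw [sum_mul]
        refine sum_congr rfl fun a _ ↦ ?_
        rw [max_mul_of_nonneg _ _ hnorm.le, map_smul, smul_eq_mul, zero_mul]
        field_simp
    _ ≤ ∑ a, exp (w a θ) := sum_le_sum fun a _ ↦
        max_le (by linarith [add_one_le_exp (w a θ)]) (exp_pos _).le

lemma exists_sum_exp_smul_eq_zero [FiniteDimensional ℝ E] (hw : ∀ d ≠ 0, ∃ a, 0 < w a d) :
    ∃ θ, ∑ a, exp (w a θ) • w a = 0 := by
  have hproper : ProperSpace E := FiniteDimensional.proper ℝ E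
  obtain ⟨δ, hδ, hle⟩ := exists_pos_mul_norm_le_sum_exp hw
  have hcont : Continuous fun θ ↦ ∑ a, exp (w a θ) := by fun_prop
  obtain ⟨θ, hmin⟩ := hcont.exists_forall_le
    (tendsto_atTop_mono hle (tendsto_norm_cocompact_atTop.const_mul_atTop hδ))
  have hderiv : HasFDerivAt (fun θ ↦ ∑ a, exp (w a θ)) (∑ a, exp (w a θ) • w a) θ :=
    HasFDerivAt.fun_sum fun a _ ↦ (w a).hasFDerivAt.exp
  exact ⟨θ, IsLocalMin.hasFDerivAt_eq_zero (Eventually.of_forall hmin) hderiv⟩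

lemma injective_sum_exp_smul (hw : ∀ d ≠ 0, ∃ a, w a d ≠ 0) :
    Function.Injective fun θ ↦ ∑ a, exp (w a θ) • w a := by
  intro θ₁ θ₂ heq
  by_contra hne
  obtain ⟨b, hb⟩ := hw (θ₁ - θ₂) (sub_ne_zero.2 hne)
  rw [map_sub] at hb
  have hpos {u v : ℝ} (h : u - v ≠ 0) : 0 < (exp u - exp v) * (u - v) := by
    rcases lt_or_gt_of_ne (sub_ne_zero.1 h) with h | h
    · exact mul_pos_of_neg_of_neg (sub_neg.2 (exp_lt_exp.2 h)) (sub_neg.2 h)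
    · exact mul_pos (sub_pos.2 (exp_lt_exp.2 h)) (sub_pos.2 h)
  have hnonneg (a : S) : 0 ≤ (exp (w a θ₁) - exp (w a θ₂)) * (w a θ₁ - w a θ₂) := by
    rcases eq_or_ne (w a θ₁ - w a θ₂) 0 with h | h
    · simp [h]
    · exact (hpos h).le
  have hsum : ∑ a, (exp (w a θ₁) - exp (w a θ₂)) * (w a θ₁ - w a θ₂) = 0 := by
    have h := congrArg (fun L : E →L[ℝ] ℝ ↦ L (θ₁ - θ₂)) heq
    simp only [_root_.sum_apply, _root_.smul_apply, smul_eq_mul] at h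
    simp only [sub_mul, sum_sub_distrib, ← map_sub, h, sub_self]
  exact (hpos hb).ne' ((sum_eq_zero_iff_of_nonneg fun a _ ↦ hnonneg a).1 hsum b (mem_univ b))

lemma existsUnique_sum_exp_smul_eq_zero [FiniteDimensional ℝ E]
    (hw : ∀ d ≠ 0, ∃ a, 0 < w a d) : ∃! θ, ∑ a, exp (w a θ) • w a = 0 :=
  existsUnique_of_exists_of_unique (exists_sum_exp_smul_eq_zero hw) fun _ _ h₁ h₂ ↦
    injective_sum_exp_smul (fun d hd ↦ (hw d hd).imp fun _ h ↦ h.ne') (h₁.trans h₂.symm)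

end ExponentialFamily

lemma negMulLog_add_mul_log_le {a b : ℝ} (ha : 0 ≤ a) (hb : 0 < b) :
    negMulLog a + a * log b ≤ b - a := by
  rcases ha.eq_or_lt with rfl | ha
  · simpa using hb.le
  have hlog : a * log (b / a) ≤ a * (b / a - 1) :=
    mul_le_mul_of_nonneg_left (log_le_sub_one_of_pos (div_pos hb ha)) ha.le
  rw [log_div hb.ne' ha.ne', mul_sub, mul_sub, mul_div_cancel₀ _ ha.ne'] at hlog
  rw [negMulLog]
  linarith

/-- The linear functional `p ↦ ∑ a, p a * f a`: the mean of `f` if `p` is a probability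
distribution. -/
noncomputable def mean {S : Type*} [Fintype S] (f : S → ℝ) : (S → ℝ) →L[ℝ] ℝ :=
  ∑ a, f a • ContinuousLinearMap.proj a

/-- The probability distribution on `S` whose masses are proportional to `exp (θ a)`. -/
noncomputable def softmax {S : Type*} [Fintype S] (θ : S → ℝ) (a : S) : ℝ :=
  exp (θ a) / ∑ b, exp (θ b)

section Mean

variable {S : Type*} [Fintype S] {f : S → ℝ}

lemma mean_apply (f p : S → ℝ) : mean f p = ∑ a, p a * f a := by
  simp [mean, mul_comm]

lemma exists_lt_of_lt_mean {p : S → ℝ} (hp : p ∈ stdSimplex ℝ S) {b : ℝ} (hb : b < mean f p) :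
    ∃ a, b < f a := by
  by_contra! h
  refine hb.not_ge ?_
  calc mean f p = ∑ a, p a * f a := mean_apply f p
    _ ≤ ∑ a, p a * b := sum_le_sum fun a _ ↦ mul_le_mul_of_nonneg_left (h a) (hp.1 a)
    _ = b := by rw [← sum_mul, hp.2, one_mul]

lemma image_mean_stdSimplex {a₀ a₁ : S} (h₀ : ∀ a, f a₀ ≤ f a) (h₁ : ∀ a, f a ≤ f a₁) :
    mean f '' stdSimplex ℝ S = Set.Icc (f a₀) (f a₁) := by
  classical
  refine subset_antisymm ?_ ?_
  · rintro _ ⟨p, hp, rfl⟩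
    constructor
    · by_contra! h
      obtain ⟨a, ha⟩ := exists_lt_of_lt_mean (f := -f) hp (b := -f a₀)
        (by simpa [mean_apply] using h)
      exact (h₀ a).not_gt (by simpa using ha)
    · by_contra! h
      obtain ⟨a, ha⟩ := exists_lt_of_lt_mean hp h
      exact (h₁ a).not_gt ha
  · have h := (convex_stdSimplex ℝ S).isPreconnected.intermediate_value
      (single_mem_stdSimplex ℝ a₀) (single_mem_stdSimplex ℝ a₁) (mean f).continuous.continuousOn
    simpa [mean_apply, Pi.single_apply] using h

end Mean

section Softmax

variable {S : Type*} [Fintype S] [Nonempty S] (θ : S → ℝ)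

lemma sum_exp_pos : 0 < ∑ a, exp (θ a) := sum_pos (fun _ _ ↦ exp_pos _) univ_nonempty

lemma softmax_pos (a : S) : 0 < softmax θ a := div_pos (exp_pos _) (sum_exp_pos θ)

lemma softmax_mem_stdSimplex : softmax θ ∈ stdSimplex ℝ S := by
  refine ⟨fun a ↦ (softmax_pos θ a).le, ?_⟩
  simp only [softmax]
  rw [← sum_div, div_self (sum_exp_pos θ).ne']

lemma log_softmax (a : S) : log (softmax θ a) = θ a - log (∑ b, exp (θ b)) := by
  rw [softmax, log_div (exp_pos _).ne' (sum_exp_pos θ).ne', log_exp]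

lemma sum_mul_log_softmax {p : S → ℝ} (hp : p ∈ stdSimplex ℝ S) :
    ∑ a, p a * log (softmax θ a) = mean θ p - log (∑ b, exp (θ b)) := by
  simp only [log_softmax, mul_sub, sum_sub_distrib, ← sum_mul, hp.2, one_mul, mean_apply]

lemma multinomialExponent_softmax :
    multinomialExponent (softmax θ) = log (∑ a, exp (θ a)) - mean θ (softmax θ) := by
  have h := softmax_mem_stdSimplex θ
  rw [multinomialExponent_eq_sub, sum_mul_log_softmax θ h, h.2]
  simp

lemma multinomialExponent_le_of_mem_stdSimplex {p : S → ℝ} (hp : p ∈ stdSimplex ℝ S) :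
    multinomialExponent p ≤ log (∑ a, exp (θ a)) - mean θ p := by
  have h := sum_le_sum fun a (_ : a ∈ univ) ↦ negMulLog_add_mul_log_le (hp.1 a) (softmax_pos θ a)
  rw [sum_add_distrib, sum_mul_log_softmax θ hp, sum_sub_distrib, hp.2,
    (softmax_mem_stdSimplex θ).2, sub_self] at h
  rw [multinomialExponent, hp.2, negMulLog_one]
  linarith

lemma isGreatest_multinomialExponent_softmax {C : Set (S → ℝ)} {b : ℝ}
    (hC : C ⊆ stdSimplex ℝ S) (hb : ∀ p ∈ C, mean θ p = b) (hθ : softmax θ ∈ C) :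
    IsGreatest (multinomialExponent '' C) (log (∑ a, exp (θ a)) - b) := by
  refine ⟨⟨_, hθ, ?_⟩, ?_⟩
  · rw [multinomialExponent_softmax, hb _ hθ]
  · rintro _ ⟨p, hp, rfl⟩
    exact hb p hp ▸ multinomialExponent_le_of_mem_stdSimplex θ (hC hp)

variable {E : Type*} [NormedAddCommGroup E] [NormedSpace ℝ E] {T : S → E →L[ℝ] ℝ} {μ : E →L[ℝ] ℝ}

lemma sum_exp_smul_sub_eq_zero_iff {θ : E} :
    ∑ a, exp ((T a - μ) θ) • (T a - μ) = 0 ↔ ∑ a, softmax (fun b ↦ T b θ) a • T a = μ := by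
  have hZ := sum_exp_pos fun a ↦ T a θ
  have hexp (a : S) : exp ((T a - μ) θ) =
      (exp (-μ θ) * ∑ b, exp (T b θ)) * softmax (fun b ↦ T b θ) a := by
    rw [softmax, mul_assoc, mul_div_cancel₀ _ hZ.ne', ← exp_add, _root_.sub_apply,
      neg_add_eq_sub]
  simp only [hexp, mul_smul _ (softmax _ _), ← smul_sum, smul_sub _ (T _), sum_sub_distrib,
    ← sum_smul, (softmax_mem_stdSimplex _).2, one_smul]
  rw [smul_eq_zero_iff_right (mul_pos (exp_pos _) hZ).ne', sub_eq_zero]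

lemma existsUnique_sum_softmax_smul_eq [FiniteDimensional ℝ E] (h : ∀ d ≠ 0, ∃ a, μ d < T a d) :
    ∃! θ, ∑ a, softmax (fun b ↦ T b θ) a • T a = μ := by
  simp only [← sum_exp_smul_sub_eq_zero_iff]
  exact existsUnique_sum_exp_smul_eq_zero fun d hd ↦ (h d hd).imp fun a ha ↦ sub_pos.2 ha

lemma existsUnique_mean_softmax_eq {f : S → ℝ} {b : ℝ} (h₀ : ∃ a, f a < b) (h₁ : ∃ a, b < f a) :
    ∃! θ : ℝ, mean f (softmax fun a ↦ f a * θ) = b := by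
  have h := existsUnique_sum_softmax_smul_eq (T := fun a ↦ f a • ContinuousLinearMap.id ℝ ℝ)
    (μ := b • ContinuousLinearMap.id ℝ ℝ) fun d hd ↦ ?_
  · simpa [ContinuousLinearMap.ext_ring_iff, mean_apply] using h
  · rcases lt_or_gt_of_ne hd with hd | hd
    · exact h₀.imp fun a ha ↦ mul_lt_mul_of_neg_right ha hd
    · exact h₁.imp fun a ha ↦ mul_lt_mul_of_pos_right ha hd

lemma existsUnique_mean_softmax_eq₂ {f g : S → ℝ} {b c : ℝ}
    (h : ∀ d : ℝ × ℝ, d ≠ 0 → ∃ a, b * d.1 + c * d.2 < f a * d.1 + g a * d.2) :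
    ∃! θ : ℝ × ℝ, mean f (softmax fun a ↦ f a * θ.1 + g a * θ.2) = b ∧
      mean g (softmax fun a ↦ f a * θ.1 + g a * θ.2) = c := by
  have h := existsUnique_sum_softmax_smul_eq
    (T := fun a ↦ f a • ContinuousLinearMap.fst ℝ ℝ ℝ + g a • ContinuousLinearMap.snd ℝ ℝ ℝ)
    (μ := b • ContinuousLinearMap.fst ℝ ℝ ℝ + c • ContinuousLinearMap.snd ℝ ℝ ℝ) h
  simpa [ContinuousLinearMap.prod_ext_iff, ContinuousLinearMap.ext_ring_iff, mean_apply] using h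

end Softmax

/-! ### Maxima over slices of compact convex sets -/

section Slice

variable {E : Type*} [NormedAddCommGroup E] [NormedSpace ℝ E] {K : Set E} {ℓ : E →L[ℝ] ℝ}

lemma nhdsWithin_uIcc_le_map_nhdsWithin (hconv : Convex ℝ K) {x₀ x₁ : E} (h₀ : x₀ ∈ K)
    (h₁ : x₁ ∈ K) : 𝓝[Set.uIcc (ℓ x₀) (ℓ x₁)] (ℓ x₀) ≤ map ℓ (𝓝[K] x₀) := by
  rcases eq_or_ne (ℓ x₁) (ℓ x₀) with heq | hne
  · rw [heq, Set.uIcc_self, nhdsWithin_singleton, ← map_pure]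
    exact map_mono (pure_le_nhdsWithin h₀)
  have hd : ℓ x₁ - ℓ x₀ ≠ 0 := sub_ne_zero.2 hne
  let g : ℝ → E := fun β ↦ AffineMap.lineMap x₀ x₁ ((β - ℓ x₀) / (ℓ x₁ - ℓ x₀))
  have hℓg (β : ℝ) : ℓ (g β) = β := by
    simp only [g, AffineMap.lineMap_apply_module', map_add, map_smul, map_sub, smul_eq_mul]
    rw [div_mul_cancel₀ _ hd, sub_add_cancel]
  refine le_map_of_right_inverse (Eventually.of_forall hℓg) (tendsto_nhdsWithin_iff.2 ⟨?_, ?_⟩)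
  · have hcont : Continuous g := by fun_prop
    simpa [g] using (hcont.tendsto (ℓ x₀)).mono_left nhdsWithin_le_nhds
  · filter_upwards [self_mem_nhdsWithin] with β hβ
    rw [← segment_eq_uIcc, segment_eq_image_lineMap] at hβ
    obtain ⟨t, ht, rfl⟩ := hβ
    have ht' : (AffineMap.lineMap (ℓ x₀) (ℓ x₁) t - ℓ x₀) / (ℓ x₁ - ℓ x₀) = t := by
      simp [AffineMap.lineMap_apply_module', mul_div_cancel_right₀ _ hd]
    exact hconv.lineMap_mem h₀ h₁ (by rwa [ht'])

lemma nhdsWithin_image_le_map_nhdsWithin (hK : IsCompact K) (hconv : Convex ℝ K) {x₀ : E}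
    (h₀ : x₀ ∈ K) : 𝓝[ℓ '' K] (ℓ x₀) ≤ map ℓ (𝓝[K] x₀) := by
  obtain ⟨xm, hxm, hmin⟩ := hK.exists_isMinOn ⟨x₀, h₀⟩ ℓ.continuous.continuousOn
  obtain ⟨xM, hxM, hmax⟩ := hK.exists_isMaxOn ⟨x₀, h₀⟩ ℓ.continuous.continuousOn
  have hsub : ℓ '' K ⊆ Set.uIcc (ℓ x₀) (ℓ xm) ∪ Set.uIcc (ℓ x₀) (ℓ xM) := by
    rintro _ ⟨x, hx, rfl⟩
    rcases le_total (ℓ x) (ℓ x₀) with h | h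
    · exact .inl (Set.mem_uIcc_of_ge (hmin hx) h)
    · exact .inr (Set.mem_uIcc_of_le h (hmax hx))
  refine (nhdsWithin_mono _ hsub).trans ?_
  rw [nhdsWithin_union]
  exact sup_le (nhdsWithin_uIcc_le_map_nhdsWithin hconv h₀ hxm)
    (nhdsWithin_uIcc_le_map_nhdsWithin hconv h₀ hxM)

/-- The supremum of `φ` on the part of `K` where `ℓ` has the value `β`. -/
noncomputable def sliceSup (K : Set E) (ℓ : E →L[ℝ] ℝ) (φ : E → ℝ) (β : ℝ) : ℝ :=
  sSup (φ '' {x ∈ K | ℓ x = β})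

variable {φ : E → ℝ}

lemma isGreatest_sliceSup (hK : IsCompact K) (hφ : Continuous φ) {β : ℝ} (hβ : β ∈ ℓ '' K) :
    IsGreatest (φ '' {x ∈ K | ℓ x = β}) (sliceSup K ℓ φ β) := by
  obtain ⟨x, hx, rfl⟩ := hβ
  have hslice : IsCompact {y ∈ K | ℓ y = ℓ x} :=
    hK.inter_right (isClosed_eq ℓ.continuous continuous_const)
  exact (hslice.image hφ).isGreatest_sSup ⟨_, x, ⟨hx, rfl⟩, rfl⟩

lemma le_sliceSup (hK : IsCompact K) (hφ : Continuous φ) {x : E} (hx : x ∈ K) :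
    φ x ≤ sliceSup K ℓ φ (ℓ x) :=
  (isGreatest_sliceSup hK hφ ⟨x, hx, rfl⟩).2 ⟨x, ⟨hx, rfl⟩, rfl⟩

lemma eventually_sliceSup_lt (hK : IsCompact K) (hφ : Continuous φ) {β₀ c : ℝ} (hβ₀ : β₀ ∈ ℓ '' K)
    (hc : sliceSup K ℓ φ β₀ < c) : ∀ᶠ β in 𝓝[ℓ '' K] β₀, sliceSup K ℓ φ β < c := by
  have hclosed : IsClosed (ℓ '' (K ∩ φ ⁻¹' Set.Ici c)) :=
    ((hK.inter_right (isClosed_Ici.preimage hφ)).image ℓ.continuous).isClosed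
  have hβ₀' : β₀ ∉ ℓ '' (K ∩ φ ⁻¹' Set.Ici c) := by
    rintro ⟨x, ⟨hx, hxc⟩, rfl⟩
    exact ((le_sliceSup hK hφ hx).trans_lt hc).not_ge hxc
  filter_upwards [self_mem_nhdsWithin,
    mem_nhdsWithin_of_mem_nhds (hclosed.isOpen_compl.mem_nhds hβ₀')] with β hβ hβ'
  obtain ⟨x, ⟨hx, hxβ⟩, hxφ⟩ := (isGreatest_sliceSup hK hφ hβ).1
  rw [← hxφ]
  exact not_le.1 fun hle ↦ hβ' ⟨x, ⟨hx, hle⟩, hxβ⟩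

lemma eventually_lt_sliceSup (hK : IsCompact K) (hconv : Convex ℝ K) (hφ : Continuous φ)
    {β₀ c : ℝ} (hβ₀ : β₀ ∈ ℓ '' K) (hc : c < sliceSup K ℓ φ β₀) :
    ∀ᶠ β in 𝓝[ℓ '' K] β₀, c < sliceSup K ℓ φ β := by
  obtain ⟨x₀, ⟨h₀, rfl⟩, hmax⟩ := (isGreatest_sliceSup hK hφ hβ₀).1
  rw [← hmax] at hc
  refine nhdsWithin_image_le_map_nhdsWithin hK hconv h₀ (mem_map.2 ?_)
  filter_upwards [self_mem_nhdsWithin,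
    mem_nhdsWithin_of_mem_nhds ((hφ.tendsto x₀).eventually_const_lt hc)] with x hx hcx
  exact hcx.trans_le (le_sliceSup hK hφ hx)

lemma continuousOn_sliceSup (hK : IsCompact K) (hconv : Convex ℝ K) (hφ : Continuous φ) :
    ContinuousOn (sliceSup K ℓ φ) (ℓ '' K) := fun _ hβ₀ ↦
  tendsto_order.2 ⟨fun _ hc ↦ eventually_lt_sliceSup hK hconv hφ hβ₀ hc,
    fun _ hc ↦ eventually_sliceSup_lt hK hφ hβ₀ hc⟩

end Slice

/-! ### Nonnegative integer points near real ones -/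

lemma abs_div_sub_le_div {n x y R : ℝ} (hn : 0 < n) (h : |x - n * y| ≤ R) :
    |x / n - y| ≤ R / n := by
  rw [← mul_div_cancel_left₀ y hn.ne', ← sub_div, abs_div, abs_of_pos hn]
  exact div_le_div_of_nonneg_right h hn.le

lemma exists_pos_le_and_forall_le {J : Type*} [Finite J] {r : J → ℝ} (hr : 0 ≤ r) {ε : ℝ}
    (hε : 0 < ε) : ∃ η > 0, η ≤ ε ∧ ∀ j, r j ≠ 0 → η ≤ r j := by
  have hsmall : ∀ᶠ η in 𝓝[>] (0 : ℝ), η ≤ ε ∧ ∀ j, r j ≠ 0 → η ≤ r j :=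
    nhdsWithin_le_nhds ((eventually_le_nhds hε).and (eventually_all.2 fun j ↦
      eventually_imp_distrib_left.2 fun hj ↦ eventually_le_nhds ((hr j).lt_of_ne' hj)))
  exact (eventually_mem_nhdsWithin.and hsmall).exists

section IntegerPoints

variable {D J : Type*} [Fintype J] (M : Matrix D J ℤ)

lemma abs_mulVec_floor_le {x : J → ℝ} (hx : M.map (Int.cast : ℤ → ℝ) *ᵥ x = 0) (d : D) :
    |(M *ᵥ fun j ↦ ⌊x j⌋) d| ≤ ∑ j, |M d j| := by
  have hfract : ((M *ᵥ fun j ↦ ⌊x j⌋) d : ℝ) = -∑ j, (M d j : ℝ) * Int.fract (x j) := by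
    rw [eq_neg_iff_add_eq_zero, ← show (M.map (Int.cast : ℤ → ℝ) *ᵥ x) d = 0 from congrFun hx d]
    simp only [Matrix.mulVec, dotProduct, Matrix.map_apply]
    push_cast
    rw [← sum_add_distrib]
    exact sum_congr rfl fun j _ ↦ by rw [← mul_add, Int.floor_add_fract]
  have hle : |((M *ᵥ fun j ↦ ⌊x j⌋) d : ℝ)| ≤ ∑ j, |(M d j : ℝ)| := by
    rw [hfract, abs_neg]
    refine (abs_sum_le_sum_abs _ _).trans (sum_le_sum fun j _ ↦ ?_)
    rw [abs_mul, abs_of_nonneg (Int.fract_nonneg (x j))]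
    exact mul_le_of_le_one_right (abs_nonneg _) (Int.fract_lt_one _).le
  exact_mod_cast hle

variable [Finite D]

/- Real solutions with the same value of `M *ᵥ ⌊x⌋` and the same support differ, after rounding, by
an integer solution. There are finitely many such classes, and one representative of each
suffices. -/
lemma exists_int_mulVec_eq_zero_near :
    ∃ R : ℝ, ∀ x : J → ℝ, M.map (Int.cast : ℤ → ℝ) *ᵥ x = 0 →
      ∃ κ : J → ℤ, M *ᵥ κ = 0 ∧ κ.support ⊆ x.support ∧ ∀ j, |(κ j : ℝ) - x j| ≤ R := by
  classical
  have := Fintype.ofFinite D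
  let fl : (J → ℝ) → J → ℤ := fun x j ↦ ⌊x j⌋
  let Φ : (J → ℝ) → (D → ℤ) × Set J := fun x ↦ (M *ᵥ fl x, x.support)
  obtain ⟨T, hTker, hT⟩ :=
    Set.exists_subset_bijOn {x | M.map (Int.cast : ℤ → ℝ) *ᵥ x = 0} Φ
  have hTfin : T.Finite := by
    refine Set.Finite.of_finite_image ?_ hT.injOn
    refine ((Set.finite_Icc (fun d ↦ -∑ j, |M d j|) fun d ↦ ∑ j, |M d j|).prod
      (Set.finite_univ (α := Set J))).subset ?_
    rintro _ ⟨x, hx, rfl⟩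
    have hb := fun d ↦ abs_le.1 (abs_mulVec_floor_le M (hTker hx) d)
    exact ⟨⟨fun d ↦ (hb d).1, fun d ↦ (hb d).2⟩, Set.mem_univ _⟩
  obtain ⟨R, hR⟩ := (hTfin.image fl).isBounded.exists_norm_le
  refine ⟨1 + R, fun x hx ↦ ?_⟩
  obtain ⟨x', hx'T, hx'⟩ := hT.surjOn ⟨x, hx, rfl⟩
  have hfl : M *ᵥ fl x' = M *ᵥ fl x := congrArg Prod.fst hx'
  have hsupp : x'.support = x.support := congrArg Prod.snd hx'
  refine ⟨fl x - fl x', ?_, fun j hj ↦ ?_, fun j ↦ ?_⟩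
  · rw [Matrix.mulVec_sub, sub_eq_zero]
    exact hfl.symm
  · rw [Function.mem_support]
    contrapose! hj
    have hj' : x' j = 0 := Function.notMem_support.1 (hsupp ▸ Function.notMem_support.2 hj)
    simp [fl, hj, hj']
  · have hx'R : |((fl x' j : ℤ) : ℝ)| ≤ R := by
      rw [← Int.norm_eq_abs]
      exact (norm_le_pi_norm (fl x') j).trans (hR _ ⟨x', hx'T, rfl⟩)
    have hfract : |(fl x j : ℝ) - x j| ≤ 1 := by
      rw [abs_sub_comm, Int.self_sub_floor, abs_of_nonneg (Int.fract_nonneg _)]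
      exact (Int.fract_lt_one _).le
    calc |((fl x - fl x') j : ℝ) - x j| = |((fl x j : ℝ) - x j) - fl x' j| := by
          rw [Pi.sub_apply]; push_cast; congr 1; ring
      _ ≤ |(fl x j : ℝ) - x j| + |(fl x' j : ℝ)| := abs_sub _ _
      _ ≤ 1 + R := add_le_add hfract hx'R

lemma exists_nat_mulVec_eq_near {r : J → ℝ} (hr : 0 ≤ r) {ε : ℝ} (hε : 0 < ε) :
    ∃ δ > 0, ∀ᶠ n : ℕ in atTop, ∀ (N : J → ℕ) (r₁ : J → ℝ), r₁.support ⊆ r.support →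
      M.map (Int.cast : ℤ → ℝ) *ᵥ r₁ = M.map (Int.cast : ℤ → ℝ) *ᵥ r →
      (∀ j, |(N j : ℝ) / n - r₁ j| < δ) →
      ∃ N' : J → ℕ, (M *ᵥ fun j ↦ (N' j : ℤ)) = (M *ᵥ fun j ↦ (N j : ℤ)) ∧
        ∀ j, |(N' j : ℝ) / n - r j| < ε := by
  obtain ⟨R, hR⟩ := exists_int_mulVec_eq_zero_near M
  obtain ⟨η, hη, hηε, hηr⟩ := exists_pos_le_and_forall_le hr hε
  refine ⟨η / 2, by positivity, ?_⟩
  filter_upwards [eventually_gt_atTop 0,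
    (tendsto_const_div_atTop_nhds_zero_nat R).eventually_lt_const (half_pos hη)]
    with n hn hRn N r₁ hsupp hM hN
  have hn' : (0 : ℝ) < n := by exact_mod_cast hn
  obtain ⟨κ, hκM, hκsupp, hκ⟩ := hR ((n : ℝ) • (r - r₁)) (by
    rw [Matrix.mulVec_smul, Matrix.mulVec_sub, hM, sub_self, smul_zero])
  have hclose (j : J) : |((N j + κ j : ℤ) : ℝ) / n - r j| < η := by
    have hκj : |(κ j : ℝ) / n - (r j - r₁ j)| ≤ R / n :=
      abs_div_sub_le_div hn' (hκ j)
    calc |((N j + κ j : ℤ) : ℝ) / n - r j|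
        = |((N j : ℝ) / n - r₁ j) + ((κ j : ℝ) / n - (r j - r₁ j))| := by
          push_cast; congr 1; ring
      _ ≤ |(N j : ℝ) / n - r₁ j| + |(κ j : ℝ) / n - (r j - r₁ j)| := abs_add_le _ _
      _ < η / 2 + η / 2 := add_lt_add (hN j) (hκj.trans_lt hRn)
      _ = η := add_halves η
  have hnonneg (j : J) : 0 ≤ (N j : ℤ) + κ j := by
    by_cases hj : r j = 0
    · have hr₁j : r₁ j = 0 := Function.notMem_support.1 fun h ↦ hsupp h hj
      have hκj : κ j = 0 := Function.notMem_support.1 fun h ↦ hκsupp h (by simp [hj, hr₁j])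
      simp [hκj]
    · have h := (abs_lt.1 (hclose j)).1
      have hpos : 0 < ((N j + κ j : ℤ) : ℝ) / n := by linarith [hηr j hj]
      exact_mod_cast (div_pos_iff_of_pos_right hn').1 hpos |>.le
  refine ⟨fun j ↦ (N j + κ j).toNat, ?_, fun j ↦ ?_⟩
  · simp only [Int.toNat_of_nonneg (hnonneg _)]
    change M *ᵥ ((fun j ↦ (N j : ℤ)) + κ) = _
    rw [Matrix.mulVec_add, hκM, add_zero]
  · have hcast : (((N j + κ j : ℤ).toNat : ℕ) : ℝ) = ((N j + κ j : ℤ) : ℝ) := by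
      exact_mod_cast Int.toNat_of_nonneg (hnonneg j)
    rw [hcast]
    exact (hclose j).trans_le hηε

lemma exists_tendsto_nat_of_mulVec_eq_zero {r : J → ℝ} (hr : 0 ≤ r)
    (hM : M.map (Int.cast : ℤ → ℝ) *ᵥ r = 0) :
    ∃ N : ℕ → J → ℕ, (∀ᶠ m in atTop, (M *ᵥ fun j ↦ (N m j : ℤ)) = 0) ∧
      ∀ j, Tendsto (fun m ↦ (N m j : ℝ) / m) atTop (𝓝 (r j)) := by
  obtain ⟨R, hR⟩ := exists_int_mulVec_eq_zero_near M
  choose κ hκM hκsupp hκ using fun m : ℕ ↦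
    hR ((m : ℝ) • r) (by rw [Matrix.mulVec_smul, hM, smul_zero])
  have hlim (j : J) : Tendsto (fun m : ℕ ↦ (κ m j : ℝ) / m) atTop (𝓝 (r j)) := by
    rw [tendsto_iff_dist_tendsto_zero]
    refine squeeze_zero' (.of_forall fun _ ↦ dist_nonneg) ?_
      (tendsto_const_div_atTop_nhds_zero_nat R)
    filter_upwards [eventually_gt_atTop 0] with m hm
    exact abs_div_sub_le_div (by exact_mod_cast hm) (hκ m j)
  have hnonneg : ∀ᶠ m in atTop, ∀ j, 0 ≤ κ m j := by
    refine eventually_all.2 fun j ↦ ?_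
    rcases (hr j).eq_or_lt with hj | hj
    · refine .of_forall fun m ↦ ge_of_eq (Function.notMem_support.1 fun h ↦ ?_)
      exact hκsupp m h (by simp [← hj])
    · filter_upwards [(hlim j).eventually_const_lt hj, eventually_gt_atTop 0] with m hpos hm
      exact_mod_cast ((div_pos_iff_of_pos_right (by exact_mod_cast hm)).1 hpos).le
  have hcast : ∀ᶠ m in atTop, (fun j ↦ ((κ m j).toNat : ℤ)) = κ m :=
    hnonneg.mono fun m hm ↦ funext fun j ↦ Int.toNat_of_nonneg (hm j)
  refine ⟨fun m j ↦ (κ m j).toNat, hcast.mono fun m hm ↦ by rw [hm, hκM], fun j ↦ ?_⟩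
  refine (hlim j).congr' (hcast.mono fun m hm ↦ ?_)
  rw [← congrFun hm j, Int.cast_natCast]

end IntegerPoints

lemma support_subset_support_smul_add_smul {J : Type*} {r r' : J → ℝ} (hr : 0 ≤ r) (hr' : 0 ≤ r')
    {a b : ℝ} (ha : 0 ≤ a) (hb : 0 < b) : r'.support ⊆ (a • r + b • r').support := fun j hj ↦
  (add_pos_of_nonneg_of_pos (mul_nonneg ha (hr j)) (mul_pos hb ((hr' j).lt_of_ne' hj))).ne'

lemma exists_maximal_support {J : Type*} [Finite J] {P : Set (J → ℝ)} (hconv : Convex ℝ P)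
    (h0 : ∀ r ∈ P, 0 ≤ r) (hne : P.Nonempty) :
    ∃ r ∈ P, ∀ r' ∈ P, r'.support ⊆ r.support := by
  obtain ⟨_, ⟨r, hr, rfl⟩, hmax⟩ :=
    (Set.toFinite (Function.support '' P)).exists_maximal (hne.image _)
  refine ⟨r, hr, fun r' hr' ↦ ?_⟩
  have hmid : (1 / 2 : ℝ) • r + (1 / 2 : ℝ) • r' ∈ P :=
    hconv hr hr' (by norm_num) (by norm_num) (by norm_num)
  have hsub : r.support ⊆ ((1 / 2 : ℝ) • r + (1 / 2 : ℝ) • r').support := by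
    rw [add_comm]
    exact support_subset_support_smul_add_smul (h0 r' hr') (h0 r hr) (by norm_num) (by norm_num)
  exact (support_subset_support_smul_add_smul (h0 r hr) (h0 r' hr') (by norm_num)
    (by norm_num)).trans (hmax ⟨_, hmid, rfl⟩ hsub)

lemma exists_maximal_support_of_lt {J : Type*} [Finite J] {P : Set (J → ℝ)} (hconv : Convex ℝ P)
    (h0 : ∀ r ∈ P, 0 ≤ r) {φ : (J → ℝ) → ℝ} (hφ : Continuous φ) {r : J → ℝ} (hr : r ∈ P) {b : ℝ}
    (hb : b < φ r) : ∃ r₁ ∈ P, (∀ r' ∈ P, r'.support ⊆ r₁.support) ∧ b < φ r₁ := by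
  obtain ⟨r₂, hr₂, hmax⟩ := exists_maximal_support hconv h0 ⟨r, hr⟩
  have hcont : Continuous fun t : ℝ ↦ φ ((1 - t) • r + t • r₂) := by fun_prop
  have hnear : ∀ᶠ t in 𝓝[>] (0 : ℝ), b < φ ((1 - t) • r + t • r₂) ∧ t < 1 :=
    nhdsWithin_le_nhds (((hcont.tendsto 0).eventually_const_lt (by simpa using hb)).and
      (eventually_lt_nhds one_pos))
  obtain ⟨t, ht0, htφ, ht1⟩ := (eventually_mem_nhdsWithin.and hnear).exists
  refine ⟨_, hconv hr hr₂ (sub_nonneg.2 ht1.le) (le_of_lt ht0) (sub_add_cancel 1 t),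
    fun r' hr' ↦ (hmax r' hr').trans ?_, htφ⟩
  exact support_subset_support_smul_add_smul (h0 r hr) (h0 r₂ hr₂) (sub_nonneg.2 ht1.le) ht0

/-! ### The expected number of codewords -/

lemma ioWef_eq_sum {k q : ℕ} (G : Matrix (Fin k) (Fin q) (ZMod 2)) (x y : ℝ) :
    ioWef G x y = ∑ a, x ^ hammingNorm a * y ^ hammingNorm (Matrix.vecMul a G) := by
  have hmaps : ∀ a ∈ univ, (hammingNorm a, hammingNorm (Matrix.vecMul a G)) ∈
      range (k + 1) ×ˢ range (q + 1) := fun a _ ↦ by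
    have ha := hammingNorm_le_card_fintype (x := a)
    have haG := hammingNorm_le_card_fintype (x := Matrix.vecMul a G)
    rw [Fintype.card_fin] at ha haG
    exact mem_product.2 ⟨mem_range.2 (by lia), mem_range.2 (by lia)⟩
  rw [← sum_fiberwise_of_maps_to hmaps, sum_product, ioWef]
  refine sum_congr rfl fun u _ ↦ sum_congr rfl fun v _ ↦ ?_
  rw [sum_congr rfl (g := fun _ ↦ x ^ u * y ^ v)
    fun a ha ↦ by rw [← (Prod.mk.inj (mem_filter.1 ha).2).1, ← (Prod.mk.inj (mem_filter.1 ha).2).2]]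
  rw [sum_const, nsmul_eq_mul, mul_assoc, ioCoeff, Nat.card_eq_fintype_card, Fintype.card_subtype]
  simp only [Prod.mk.injEq]

lemma card_hammingNorm_eq_wefCoeff {s : ℕ} (C : Submodule (ZMod 2) (Fin s → ZMod 2)) (u : ℕ) :
    Nat.card {c : C // hammingNorm c.1 = u} = wefCoeff C u :=
  Nat.card_congr (Equiv.subtypeSubtypeEquivSubtypeInter (· ∈ C) (hammingNorm · = u))

lemma wef_eq_sum {s : ℕ} (C : Submodule (ZMod 2) (Fin s → ZMod 2)) [Fintype C] (z : ℝ) :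
    wef C z = ∑ c : C, z ^ hammingNorm c.1 := by
  have hmaps : ∀ c ∈ (univ : Finset C), hammingNorm c.1 ∈ range (s + 1) := fun c _ ↦ by
    have hc := hammingNorm_le_card_fintype (x := c.1)
    rw [Fintype.card_fin] at hc
    exact mem_range.2 (by lia)
  rw [← sum_fiberwise_of_maps_to hmaps, wef]
  refine sum_congr rfl fun u _ ↦ ?_
  rw [sum_congr rfl (g := fun _ ↦ z ^ u) fun c hc ↦ by rw [(mem_filter.1 hc).2], sum_const,
    nsmul_eq_mul, ← card_hammingNorm_eq_wefCoeff, Nat.card_eq_fintype_card, Fintype.card_subtype]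

lemma hammingNorm_prod {ι κ : Type*} [Fintype ι] [Fintype κ] (x : ι × κ → ZMod 2) :
    hammingNorm x = ∑ i, hammingNorm fun e ↦ x (i, e) := by
  simp only [hammingNorm, card_filter]
  rw [Fintype.sum_prod_type]

section RandomBijection

variable {ι κ : Type*} [Fintype ι] [Fintype κ] [DecidableEq ι] [DecidableEq κ]

omit [DecidableEq ι] in
lemma wordType_one (x : ι → ZMod 2) : wordType x 1 = hammingNorm x := by
  have h : ∀ b : ZMod 2, b = 1 ↔ b ≠ 0 := by decide
  simp only [wordType, hammingNorm, h]

omit [DecidableEq ι] in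
lemma wordType_zero (x : ι → ZMod 2) : wordType x 0 = Fintype.card ι - hammingNorm x := by
  rw [← wordType_one, ← sum_wordType x]
  exact Nat.eq_sub_of_add_eq (Fin.sum_univ_two (wordType x)).symm

omit [DecidableEq ι] [DecidableEq κ] in
lemma wordType_eq_iff_hammingNorm_eq (h : Fintype.card ι = Fintype.card κ) (x : ι → ZMod 2)
    (y : κ → ZMod 2) : wordType x = wordType y ↔ hammingNorm x = hammingNorm y := by
  refine ⟨fun hxy ↦ by rw [← wordType_one, hxy, wordType_one], fun hxy ↦ funext fun b ↦ ?_⟩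
  have hb : b = 0 ∨ b = 1 := by decide +revert
  rcases hb with rfl | rfl
  · rw [wordType_zero, wordType_zero, h, hxy]
  · rw [wordType_one, wordType_one, hxy]

lemma card_equiv_comp_symm_eq_div_card (h : Fintype.card ι = Fintype.card κ) (x : ι → ZMod 2)
    (y : κ → ZMod 2) :
    (#{τ : ι ≃ κ | x ∘ τ.symm = y} : ℝ) / Fintype.card (ι ≃ κ) =
      if hammingNorm x = hammingNorm y then
        ((Fintype.card ι).choose (hammingNorm x) : ℝ)⁻¹ else 0 := by
  have hcomp : ∀ τ : ι ≃ κ, x ∘ τ.symm = y ↔ y ∘ τ = x := fun τ ↦ by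
    rw [Equiv.comp_symm_eq, eq_comm]
  have hle : hammingNorm x ≤ Fintype.card ι := hammingNorm_le_card_fintype
  simp only [hcomp, ← wordType_eq_iff_hammingNorm_eq h]
  split_ifs with hxy
  · have hprod : ∏ b, (wordType x b).factorial =
        (Fintype.card ι - hammingNorm x).factorial * (hammingNorm x).factorial := by
      rw [← wordType_zero, ← wordType_one]
      exact Fin.prod_univ_two fun b : ZMod 2 ↦ (wordType x b).factorial
    rw [card_equiv_comp_eq hxy, hprod, Fintype.card_equiv (Fintype.equivOfCardEq h),
      Nat.cast_choose ℝ hle, inv_div, Nat.cast_mul, mul_comm]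
  · have hempty : ({τ : ι ≃ κ | y ∘ τ = x} : Finset (ι ≃ κ)) = ∅ :=
      filter_eq_empty_iff.2 fun τ _ hτ ↦ hxy (hτ ▸ wordType_comp_equiv y τ)
    rw [hempty, card_empty, Nat.cast_zero, zero_div]

lemma card_equiv_comp_symm_mem_div_card (h : Fintype.card ι = Fintype.card κ) (x : ι → ZMod 2)
    (C : Finset (κ → ZMod 2)) :
    (#{τ : ι ≃ κ | x ∘ τ.symm ∈ C} : ℝ) / Fintype.card (ι ≃ κ) =
      ∑ y ∈ C, if hammingNorm x = hammingNorm y then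
        ((Fintype.card ι).choose (hammingNorm x) : ℝ)⁻¹ else 0 := by
  have hmaps : Set.MapsTo (fun τ : ι ≃ κ ↦ x ∘ τ.symm) ({τ | x ∘ τ.symm ∈ C} : Finset (ι ≃ κ)) C :=
    fun τ hτ ↦ (mem_filter.1 hτ).2
  rw [card_eq_sum_card_fiberwise hmaps, Nat.cast_sum, sum_div]
  refine sum_congr rfl fun y hy ↦ ?_
  rw [← card_equiv_comp_symm_eq_div_card h, filter_filter]
  congr 3
  exact filter_congr fun τ _ ↦ ⟨And.right, fun hτ ↦ ⟨hτ ▸ hy, hτ⟩⟩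

end RandomBijection

namespace StronglyRegularEnsemble

variable {k q s : ℕ} (𝓜 : StronglyRegularEnsemble k q s)

noncomputable instance : Fintype 𝓜.cnRep := Fintype.ofFinite _

/-- The weight of the local codeword that the reference VN generates from the input word `a`. -/
def outWeight (a : Fin k → ZMod 2) : ℕ := hammingNorm (Matrix.vecMul a 𝓜.vnRep)

/-- The word that the VNs send along the edges. -/
def edgeWord (n : ℕ) (a : Fin n → Fin k → ZMod 2) (e : Fin n × Fin q) : ZMod 2 :=
  Matrix.vecMul (a e.1) (𝓜.vn n e.1) e.2

open Classical in
/-- The words on the CN sockets that every CN accepts. -/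
noncomputable def checkWords (n : ℕ) : Finset (Fin (n * q / s) × Fin s → ZMod 2) :=
  {y | ∀ i, (fun e ↦ y (i, e)) ∈ 𝓜.cn n i}

lemma exists_vn_equiv (n : ℕ) (j : Fin n) : ∃ e : (Fin k → ZMod 2) ≃ (Fin k → ZMod 2),
    ∀ a, hammingNorm (e a) = hammingNorm a ∧
      hammingNorm (Matrix.vecMul (e a) (𝓜.vn n j)) = 𝓜.outWeight a := by
  obtain ⟨e, he⟩ := exists_equiv_comp_eq_of_card_fiber_eq
    (fun a ↦ (hammingNorm a, 𝓜.outWeight a))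
    (fun a ↦ (hammingNorm a, hammingNorm (Matrix.vecMul a (𝓜.vn n j))))
    fun c ↦ by simpa only [ioCoeff, Prod.ext_iff, outWeight] using (𝓜.vn_type n j c.1 c.2).symm
  exact ⟨e, fun a ↦ Prod.ext_iff.1 (congrFun he a)⟩

lemma exists_cn_equiv (n : ℕ) (i : Fin (n * q / s)) : ∃ e : 𝓜.cnRep ≃ 𝓜.cn n i,
    ∀ c, hammingNorm (e c).1 = hammingNorm c.1 := by
  obtain ⟨e, he⟩ := exists_equiv_comp_eq_of_card_fiber_eq
    (fun c : 𝓜.cnRep ↦ hammingNorm c.1) (fun c : 𝓜.cn n i ↦ hammingNorm c.1) fun u ↦ by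
      rw [card_hammingNorm_eq_wefCoeff, card_hammingNorm_eq_wefCoeff, 𝓜.cn_type]
  exact ⟨e, congrFun he⟩

lemma sum_vnWords_eq (n : ℕ) (f : ℕ → ℕ → ℝ) :
    ∑ a, f (∑ j, hammingNorm (a j)) (hammingNorm (𝓜.edgeWord n a)) =
      ∑ a : Fin n → Fin k → ZMod 2, f (∑ j, hammingNorm (a j)) (∑ j, 𝓜.outWeight (a j)) := by
  choose e he using 𝓜.exists_vn_equiv n
  rw [← Equiv.sum_comp (Equiv.piCongrRight e)]
  refine sum_congr rfl fun a _ ↦ ?_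
  rw [hammingNorm_prod]
  exact congrArg₂ f (sum_congr rfl fun j _ ↦ (he j (a j)).1)
    (sum_congr rfl fun j _ ↦ (he j (a j)).2)

lemma sum_checkWords_eq (n : ℕ) (f : ℕ → ℝ) :
    ∑ y ∈ 𝓜.checkWords n, f (hammingNorm y) =
      ∑ c : Fin (n * q / s) → 𝓜.cnRep, f (∑ i, hammingNorm (c i).1) := by
  choose e he using 𝓜.exists_cn_equiv n
  symm
  refine sum_bij (fun c _ p ↦ (e p.1 (c p.1)).1 p.2) (fun c _ ↦ ?_) (fun c _ c' _ h ↦ ?_)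
    (fun y hy ↦ ?_) fun c _ ↦ ?_
  · simp only [checkWords, mem_filter, mem_univ, true_and]
    exact fun i ↦ (e i (c i)).2
  · exact funext fun i ↦ (e i).injective (Subtype.ext (funext fun l ↦ congrFun h (i, l)))
  · simp only [checkWords, mem_filter, mem_univ, true_and] at hy
    exact ⟨fun i ↦ (e i).symm ⟨_, hy i⟩, mem_univ _, by simp⟩
  · rw [hammingNorm_prod]
    simp only [he]

lemma expNumCodewords_eq_sum_div (n w : ℕ) :
    𝓜.expNumCodewords n w = ∑ a : Fin n → Fin k → ZMod 2, if ∑ j, hammingNorm (a j) = w then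
      (#{τ : 𝓜.Member n | 𝓜.edgeWord n a ∘ τ.symm ∈ 𝓜.checkWords n} : ℝ) /
        Fintype.card (𝓜.Member n) else 0 := by
  classical
  have h : ∀ τ a, 𝓜.edgeWord n a ∘ τ.symm ∈ 𝓜.checkWords n ↔ 𝓜.IsCodeword n τ a := fun τ a ↦ by
    simp [checkWords, IsCodeword, edgeWord]
  simp only [expNumCodewords, numCodewords, Nat.card_eq_fintype_card, Fintype.card_subtype,
    card_filter, Nat.cast_sum, h]
  rw [sum_comm, sum_div]
  refine sum_congr rfl fun a _ ↦ ?_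
  split_ifs with hw <;> simp [hw]

/-- The pairs of tuples of VN input words and CN codewords of the reference nodes with total input
weight `w` and with equal weights at the two ends of the edges. -/
noncomputable def wordPairs (n w : ℕ) :
    Finset ((Fin n → Fin k → ZMod 2) × (Fin (n * q / s) → 𝓜.cnRep)) :=
  {p | ∑ j, hammingNorm (p.1 j) = w ∧ ∑ j, 𝓜.outWeight (p.1 j) = ∑ i, hammingNorm (p.2 i).1}

lemma expNumCodewords_eq_sum_wordPairs {n : ℕ} (w : ℕ) (hn : s ∣ n * q) :
    𝓜.expNumCodewords n w =
      ∑ p ∈ 𝓜.wordPairs n w, ((n * q).choose (∑ j, 𝓜.outWeight (p.1 j)) : ℝ)⁻¹ := by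
  have hcard : Fintype.card (Fin n × Fin q) = Fintype.card (Fin (n * q / s) × Fin s) := by
    simp [Nat.div_mul_cancel hn]
  let P (u : ℕ) : ℝ := ∑ c : Fin (n * q / s) → 𝓜.cnRep,
    if u = ∑ i, hammingNorm (c i).1 then ((n * q).choose u : ℝ)⁻¹ else 0
  have hP : ∀ a, (#{τ : 𝓜.Member n | 𝓜.edgeWord n a ∘ τ.symm ∈ 𝓜.checkWords n} : ℝ) /
      Fintype.card (𝓜.Member n) = P (hammingNorm (𝓜.edgeWord n a)) := fun a ↦ by
    rw [card_equiv_comp_symm_mem_div_card hcard, 𝓜.sum_checkWords_eq n fun u ↦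
      if _ = u then _ else 0, Fintype.card_prod, Fintype.card_fin, Fintype.card_fin]
  simp only [expNumCodewords_eq_sum_div, hP]
  rw [𝓜.sum_vnWords_eq n fun v u ↦ if v = w then P u else 0, wordPairs, sum_filter,
    Fintype.sum_prod_type]
  refine sum_congr rfl fun a _ ↦ ?_
  split_ifs with hw <;> simp [P, hw]

/-! ### Joint types -/

section JointTypes

lemma outWeight_le (a : Fin k → ZMod 2) : 𝓜.outWeight a ≤ q := by
  simpa [outWeight] using hammingNorm_le_card_fintype (x := Matrix.vecMul a 𝓜.vnRep)

lemma exists_cnRep_ne_zero : ∃ c : 𝓜.cnRep, c.1 ≠ 0 := by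
  obtain ⟨c, hc, h0⟩ := (Submodule.ne_bot_iff _).1 𝓜.cnRep_ne_bot
  exact ⟨⟨c, hc⟩, h0⟩

lemma s_pos (𝓜 : StronglyRegularEnsemble k q s) : 0 < s := by
  obtain ⟨c, hc⟩ := 𝓜.exists_cnRep_ne_zero
  refine Nat.pos_of_ne_zero ?_
  rintro rfl
  exact hc (Subsingleton.elim _ _)

/-- The local words of the reference VN (given by their inputs) and of the reference CN. -/
abbrev Letter : Type := (Fin k → ZMod 2) ⊕ 𝓜.cnRep

/-- `N` counts how often each local word occurs in an assignment of local words to `n` VNs and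
their CNs that has total input weight `w` and equal weights at the two ends of the edges. -/
structure IsJointType (n w : ℕ) (N : 𝓜.Letter → ℕ) : Prop where
  vn : ∑ a, N (.inl a) = n
  cn : (∑ c, N (.inr c)) * s = n * q
  input : ∑ a, N (.inl a) * hammingNorm a = w
  edge : ∑ a, N (.inl a) * 𝓜.outWeight a = ∑ c, N (.inr c) * hammingNorm c.1

/-- The expected number of codewords of a joint type `N` with `n` VNs. -/
noncomputable def expNumOfType (n : ℕ) (N : 𝓜.Letter → ℕ) : ℝ :=
  Nat.multinomial univ (fun a ↦ N (.inl a)) * Nat.multinomial univ (fun c ↦ N (.inr c)) /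
    (n * q).choose (∑ a, N (.inl a) * 𝓜.outWeight a)

/-- The exponential growth rate of `expNumOfType` at the normalized joint type `r`. -/
noncomputable def exponent (r : 𝓜.Letter → ℝ) : ℝ :=
  multinomialExponent (fun a ↦ r (.inl a)) + multinomialExponent (fun c ↦ r (.inr c)) -
    q * binEntropy ((∑ a, r (.inl a) * 𝓜.outWeight a) / q)

/-- A bound for the logarithms of the factors that are polynomial in `n`. -/
noncomputable def logError (n : ℕ) : ℝ :=
  (Fintype.card 𝓜.Letter + 2) * (1 + log (n * (q + 1) + 1))

/-- The joint type of a pair of tuples of words. -/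
def pairType {n m : ℕ} (p : (Fin n → Fin k → ZMod 2) × (Fin m → 𝓜.cnRep)) : 𝓜.Letter → ℕ :=
  Sum.elim (wordType p.1) (wordType p.2)

/-- The joint types of the pairs of tuples of words that contribute to `expNumCodewords n w`. -/
noncomputable def jointTypes (n w : ℕ) : Finset (𝓜.Letter → ℕ) :=
  (𝓜.wordPairs n w).image 𝓜.pairType

lemma continuous_exponent : Continuous 𝓜.exponent := by
  have hv : Continuous fun r : 𝓜.Letter → ℝ ↦ multinomialExponent fun a ↦ r (.inl a) :=
    continuous_multinomialExponent.comp (by fun_prop)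
  have hc : Continuous fun r : 𝓜.Letter → ℝ ↦ multinomialExponent fun c ↦ r (.inr c) :=
    continuous_multinomialExponent.comp (by fun_prop)
  unfold exponent
  fun_prop

variable {𝓜}
variable {n w : ℕ} {N : 𝓜.Letter → ℕ}

lemma IsJointType.dvd (h : 𝓜.IsJointType n w N) : s ∣ n * q :=
  ⟨_, by rw [← h.cn, mul_comm]⟩

lemma IsJointType.sum_inr (h : 𝓜.IsJointType n w N) : ∑ c, N (.inr c) = n * q / s := by
  rw [← h.cn, Nat.mul_div_cancel _ 𝓜.s_pos]

lemma IsJointType.sum_outWeight_le (h : 𝓜.IsJointType n w N) :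
    ∑ a, N (.inl a) * 𝓜.outWeight a ≤ n * q := by
  rw [← h.vn, sum_mul]
  exact sum_le_sum fun a _ ↦ Nat.mul_le_mul_left _ (𝓜.outWeight_le a)

lemma IsJointType.expNumOfType_pos (h : 𝓜.IsJointType n w N) : 0 < 𝓜.expNumOfType n N := by
  have hv := Nat.multinomial_pos univ fun a ↦ N (.inl a)
  have hc := Nat.multinomial_pos univ fun c ↦ N (.inr c)
  have he := Nat.choose_pos h.sum_outWeight_le
  unfold expNumOfType
  positivity

lemma mem_wordPairs_iff (hd : s ∣ n * q)
    (p : (Fin n → Fin k → ZMod 2) × (Fin (n * q / s) → 𝓜.cnRep)) :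
    p ∈ 𝓜.wordPairs n w ↔ 𝓜.IsJointType n w (𝓜.pairType p) := by
  have hv := sum_wordType p.1
  have hc := sum_wordType p.2
  rw [Fintype.card_fin] at hv hc
  simp only [wordPairs, mem_filter, mem_univ, true_and]
  rw [sum_comp_eq_sum_wordType_mul p.1 hammingNorm, sum_comp_eq_sum_wordType_mul p.1 𝓜.outWeight,
    sum_comp_eq_sum_wordType_mul p.2 fun c ↦ hammingNorm c.1]
  refine ⟨fun ⟨hinput, hedge⟩ ↦ ⟨hv, ?_, hinput, hedge⟩, fun h ↦ ⟨h.input, h.edge⟩⟩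
  exact (congrArg (· * s) hc).trans (Nat.div_mul_cancel hd)

lemma mem_jointTypes_iff (hd : s ∣ n * q) : N ∈ 𝓜.jointTypes n w ↔ 𝓜.IsJointType n w N := by
  simp only [jointTypes, mem_image, mem_wordPairs_iff hd]
  refine ⟨fun ⟨_, hp, hN⟩ ↦ hN ▸ hp, fun h ↦ ?_⟩
  obtain ⟨f, hf⟩ := exists_wordType_eq (ι := Fin n) (N := fun a ↦ N (.inl a)) (by simpa using h.vn)
  obtain ⟨g, hg⟩ := exists_wordType_eq (ι := Fin (n * q / s)) (N := fun c ↦ N (.inr c))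
    (by simpa using h.sum_inr)
  have hN : 𝓜.pairType (f, g) = N := by
    rw [pairType, hf, hg]
    exact Sum.elim_comp_inl_inr N
  exact ⟨(f, g), hN.symm ▸ h, hN⟩

lemma IsJointType.card_pairType_eq (h : 𝓜.IsJointType n w N) :
    #{p ∈ 𝓜.wordPairs n w | 𝓜.pairType p = N} =
      Nat.multinomial univ (fun a ↦ N (.inl a)) * Nat.multinomial univ fun c ↦ N (.inr c) := by
  rw [← card_wordType_eq (ι := Fin n) (by simpa using h.vn),
    ← card_wordType_eq (ι := Fin (n * q / s)) (by simpa using h.sum_inr), ← card_product]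
  congr 1
  ext p
  have hN : 𝓜.pairType p = N ↔
      (wordType p.1 = fun a ↦ N (.inl a)) ∧ wordType p.2 = fun c ↦ N (.inr c) := by
    simp [funext_iff, pairType]
  simp only [mem_filter, mem_product, mem_univ, true_and]
  rw [mem_wordPairs_iff h.dvd, ← hN]
  exact ⟨And.right, fun hp ↦ ⟨hp ▸ h, hp⟩⟩

lemma expNumCodewords_eq_sum_expNumOfType (hd : s ∣ n * q) :
    𝓜.expNumCodewords n w = ∑ N ∈ 𝓜.jointTypes n w, 𝓜.expNumOfType n N := by
  rw [expNumCodewords_eq_sum_wordPairs 𝓜 w hd, ← sum_fiberwise_of_maps_to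
    fun p hp ↦ mem_image_of_mem 𝓜.pairType hp]
  refine sum_congr rfl fun N hN ↦ ?_
  have h := (mem_jointTypes_iff hd).1 hN
  rw [sum_congr rfl (g := fun _ ↦ ((n * q).choose (∑ a, N (.inl a) * 𝓜.outWeight a) : ℝ)⁻¹)]
  · rw [sum_const, nsmul_eq_mul, h.card_pairType_eq, Nat.cast_mul, expNumOfType, div_eq_mul_inv]
  · intro p hp
    rw [sum_comp_eq_sum_wordType_mul p.1 𝓜.outWeight, ← (mem_filter.1 hp).2]
    rfl

variable (𝓜) in
lemma card_jointTypes_le (n w : ℕ) :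
    #(𝓜.jointTypes n w) ≤ (n * (q + 1) + 1) ^ Fintype.card 𝓜.Letter := by
  have hsub : 𝓜.jointTypes n w ⊆ Fintype.piFinset fun _ ↦ range (n * (q + 1) + 1) := by
    refine image_subset_iff.2 fun p _ ↦ Fintype.mem_piFinset.2 fun j ↦ mem_range.2 ?_
    have hm : n * q / s ≤ n * q := Nat.div_le_self _ _
    rcases j with a | c
    · have := wordType_le_card p.1 a
      simp only [Fintype.card_fin] at this
      simp only [pairType, Sum.elim_inl]
      nlinarith
    · have := wordType_le_card p.2 c
      simp only [Fintype.card_fin] at this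
      simp only [pairType, Sum.elim_inr]
      nlinarith
  simpa using card_le_card hsub

lemma mul_exponent_div (hn : 0 < n) (N : 𝓜.Letter → ℕ) :
    n * 𝓜.exponent (fun j ↦ (N j : ℝ) / n) =
      multinomialExponent (fun a ↦ (N (.inl a) : ℝ)) +
        multinomialExponent (fun c ↦ (N (.inr c) : ℝ)) -
        (n * q : ℕ) * binEntropy ((∑ a, N (.inl a) * 𝓜.outWeight a : ℕ) / (n * q : ℕ)) := by
  have hn' : (n : ℝ) ≠ 0 := by positivity
  have hsmul : ∀ {J : Type} [Fintype J] (f : J → ℝ),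
      n * multinomialExponent (fun j ↦ f j / n) = multinomialExponent f := fun f ↦ by
    rw [← multinomialExponent_smul]
    exact congrArg _ (funext fun j ↦ mul_div_cancel₀ _ hn')
  rw [exponent, mul_sub, mul_add, hsmul, hsmul]
  simp only [div_mul_eq_mul_div, ← sum_div, div_div]
  push_cast
  ring

lemma card_add_card_mul_one_add_log_le {m : ℕ} (hm : m ≤ n * (q + 1)) :
    Fintype.card (Fin k → ZMod 2) * (1 + log ((n : ℝ) + 1)) +
      Fintype.card 𝓜.cnRep * (1 + log ((m : ℝ) + 1)) ≤
    Fintype.card 𝓜.Letter * (1 + log (n * (q + 1) + 1)) := by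
  have hlog : ∀ i : ℕ, i ≤ n * (q + 1) →
      1 + log ((i : ℝ) + 1) ≤ 1 + log (n * (q + 1) + 1) := fun i hi ↦ by
    gcongr
    exact_mod_cast hi
  rw [Fintype.card_sum, Nat.cast_add, add_mul]
  exact add_le_add (mul_le_mul_of_nonneg_left (hlog n (by nlinarith)) (by positivity))
    (mul_le_mul_of_nonneg_left (hlog m hm) (by positivity))

lemma IsJointType.log_expNumOfType (h : 𝓜.IsJointType n w N) :
    log (𝓜.expNumOfType n N) =
      log (Nat.multinomial univ fun a ↦ N (.inl a)) +
        log (Nat.multinomial univ fun c ↦ N (.inr c)) -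
        log ((n * q).choose (∑ a, N (.inl a) * 𝓜.outWeight a)) := by
  have hv := Nat.multinomial_pos univ fun a ↦ N (.inl a)
  have hc := Nat.multinomial_pos univ fun c ↦ N (.inr c)
  have he := Nat.choose_pos h.sum_outWeight_le
  rw [expNumOfType, log_div (by positivity) (by positivity),
    log_mul (by positivity) (by positivity)]

lemma IsJointType.le_log_expNumOfType (hn : 0 < n) (h : 𝓜.IsJointType n w N) :
    n * 𝓜.exponent (fun j ↦ (N j : ℝ) / n) - 𝓜.logError n ≤ log (𝓜.expNumOfType n N) := by
  have hv := le_log_multinomial fun a ↦ N (.inl a)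
  have hc := le_log_multinomial fun c ↦ N (.inr c)
  have he := log_choose_le h.sum_outWeight_le
  have hm : n * q / s ≤ n * (q + 1) := (Nat.div_le_self _ _).trans (by lia)
  have herr := card_add_card_mul_one_add_log_le (𝓜 := 𝓜) hm
  have hlog : 0 ≤ log ((n : ℝ) * (q + 1) + 1) := log_nonneg (by
    have : (0 : ℝ) ≤ n * (q + 1) := by positivity
    linarith)
  rw [h.vn] at hv
  rw [h.sum_inr] at hc
  rw [h.log_expNumOfType, mul_exponent_div hn, logError]
  linarith

lemma IsJointType.log_expNumOfType_le (hn : 0 < n) (h : 𝓜.IsJointType n w N) :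
    log (𝓜.expNumOfType n N) ≤
      n * 𝓜.exponent (fun j ↦ (N j : ℝ) / n) + 2 * (1 + log (n * (q + 1) + 1)) := by
  have hv := log_multinomial_le fun a ↦ N (.inl a)
  have hc := log_multinomial_le fun c ↦ N (.inr c)
  have he := le_log_choose h.sum_outWeight_le
  have hlog : log ((n * q : ℕ) + 1 : ℝ) ≤ log (n * (q + 1) + 1) := by
    gcongr
    push_cast
    nlinarith
  rw [h.log_expNumOfType, mul_exponent_div hn]
  linarith

lemma IsJointType.expNumOfType_le_expNumCodewords (h : 𝓜.IsJointType n w N) :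
    𝓜.expNumOfType n N ≤ 𝓜.expNumCodewords n w := by
  rw [expNumCodewords_eq_sum_expNumOfType h.dvd]
  exact single_le_sum (fun N hN ↦ ((mem_jointTypes_iff h.dvd).1 hN).expNumOfType_pos.le)
    ((mem_jointTypes_iff h.dvd).2 h)

lemma IsJointType.expNumCodewords_pos (h : 𝓜.IsJointType n w N) : 0 < 𝓜.expNumCodewords n w :=
  h.expNumOfType_pos.trans_le h.expNumOfType_le_expNumCodewords

lemma IsJointType.le_log_expNumCodewords (hn : 0 < n) (h : 𝓜.IsJointType n w N) :
    n * 𝓜.exponent (fun j ↦ (N j : ℝ) / n) - 𝓜.logError n ≤ log (𝓜.expNumCodewords n w) :=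
  (h.le_log_expNumOfType hn).trans
    (log_le_log h.expNumOfType_pos h.expNumOfType_le_expNumCodewords)

lemma exists_isJointType_of_expNumCodewords_pos (hd : s ∣ n * q)
    (hpos : 0 < 𝓜.expNumCodewords n w) : ∃ N, 𝓜.IsJointType n w N := by
  rw [expNumCodewords_eq_sum_expNumOfType hd] at hpos
  obtain ⟨N, hN⟩ := nonempty_of_sum_ne_zero hpos.ne'
  exact ⟨N, (mem_jointTypes_iff hd).1 hN⟩

lemma log_expNumCodewords_le (hn : 0 < n) (hd : s ∣ n * q) (hpos : 0 < 𝓜.expNumCodewords n w)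
    {b : ℝ} (hb : ∀ N, 𝓜.IsJointType n w N → 𝓜.exponent (fun j ↦ (N j : ℝ) / n) ≤ b) :
    log (𝓜.expNumCodewords n w) ≤ n * b + 𝓜.logError n := by
  set L : ℝ := log (n * (q + 1) + 1) with hL
  have hsum : 𝓜.expNumCodewords n w ≤ #(𝓜.jointTypes n w) * exp (n * b + 2 * (1 + L)) := by
    rw [expNumCodewords_eq_sum_expNumOfType hd, ← nsmul_eq_mul]
    refine sum_le_card_nsmul _ _ _ fun N hN ↦ ?_
    have h := (mem_jointTypes_iff hd).1 hN
    rw [← log_le_iff_le_exp h.expNumOfType_pos]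
    have hbN := mul_le_mul_of_nonneg_left (hb N h) (Nat.cast_nonneg (α := ℝ) n)
    linarith [h.log_expNumOfType_le hn]
  have hcard : (#(𝓜.jointTypes n w) : ℝ) ≤ (n * (q + 1) + 1) ^ Fintype.card 𝓜.Letter := by
    exact_mod_cast 𝓜.card_jointTypes_le n w
  have hlog := log_le_log hpos
    (hsum.trans (mul_le_mul_of_nonneg_right hcard (exp_pos _).le))
  rw [log_mul (by positivity) (exp_pos _).ne', log_exp, log_pow, ← hL] at hlog
  rw [logError, ← hL]
  linarith [Nat.cast_nonneg (α := ℝ) (Fintype.card 𝓜.Letter)]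

variable (𝓜) in
lemma tendsto_logError_div : Tendsto (fun n : ℕ ↦ 𝓜.logError n / n) atTop (𝓝 0) := by
  have hx : Tendsto (fun n : ℕ ↦ (n : ℝ) * (q + 1) + 1) atTop atTop :=
    tendsto_atTop_add_const_right _ _
      (tendsto_natCast_atTop_atTop.atTop_mul_const (by positivity))
  have hlog := isLittleO_log_id_atTop.comp_tendsto hx
  have hlin : (fun n : ℕ ↦ (n : ℝ) * (q + 1) + 1) =O[atTop] fun n : ℕ ↦ (n : ℝ) := by
    refine .of_bound (q + 2) ((eventually_ge_atTop 1).mono fun n hn ↦ ?_)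
    have hn : (1 : ℝ) ≤ n := by exact_mod_cast hn
    rw [norm_of_nonneg (by positivity), norm_of_nonneg (by positivity)]
    linarith
  have hone : (fun _ : ℕ ↦ (1 : ℝ)) =o[atTop] fun n : ℕ ↦ (n : ℝ) :=
    (isLittleO_const_id_atTop 1).natCast_atTop
  exact ((hone.add (hlog.trans_isBigO hlin)).const_mul_left _).tendsto_div_nhds_zero

end JointTypes

/-! ### The polytope of limiting joint types -/

/-- The mean input weight of a normalized joint type. -/
def inputMean (r : 𝓜.Letter → ℝ) : ℝ := ∑ a, r (.inl a) * hammingNorm a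

/-- The limits of normalized joint types. -/
def typeSpace : Set (𝓜.Letter → ℝ) :=
  {r | 0 ≤ r ∧ ∑ a, r (.inl a) = 1 ∧ ∑ c, r (.inr c) = q / s ∧
    ∑ a, r (.inl a) * 𝓜.outWeight a = ∑ c, r (.inr c) * hammingNorm c.1}

/-- The limits of normalized joint types with mean input weight `α`. -/
def typePolytope (α : ℝ) : Set (𝓜.Letter → ℝ) := {r ∈ 𝓜.typeSpace | 𝓜.inputMean r = α}

/-- The linear forms that define joint types: the numbers of VNs and of CNs, the input weight, and
the difference of the weights at the two ends of the edges. -/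
def constraintMatrix : Matrix (Fin 4) 𝓜.Letter ℤ :=
  .of ![Sum.elim 1 0, Sum.elim 0 1, Sum.elim (fun a ↦ hammingNorm a) 0,
    Sum.elim (fun a ↦ 𝓜.outWeight a) fun c ↦ -hammingNorm c.1]

lemma constraintMatrix_mulVec {R : Type*} [CommRing R] (r : 𝓜.Letter → R) :
    𝓜.constraintMatrix.map Int.cast *ᵥ r = ![∑ a, r (.inl a), ∑ c, r (.inr c),
      ∑ a, r (.inl a) * hammingNorm a,
      ∑ a, r (.inl a) * 𝓜.outWeight a - ∑ c, r (.inr c) * hammingNorm c.1] := by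
  ext d
  fin_cases d <;>
    simp [constraintMatrix, Matrix.mulVec, dotProduct, mul_comm, sub_eq_add_neg]

lemma constraintMatrix_mulVec_natCast (N : 𝓜.Letter → ℕ) :
    (𝓜.constraintMatrix *ᵥ fun j ↦ (N j : ℤ)) =
      ![((∑ a, N (.inl a) : ℕ) : ℤ), ((∑ c, N (.inr c) : ℕ) : ℤ),
        ((∑ a, N (.inl a) * hammingNorm a : ℕ) : ℤ),
        ((∑ a, N (.inl a) * 𝓜.outWeight a : ℕ) : ℤ) -
          ((∑ c, N (.inr c) * hammingNorm c.1 : ℕ) : ℤ)] := by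
  have h := 𝓜.constraintMatrix_mulVec fun j ↦ (N j : ℤ)
  have hcast : 𝓜.constraintMatrix.map (Int.cast : ℤ → ℤ) = 𝓜.constraintMatrix := by ext; simp
  rw [hcast] at h
  rw [h]
  push_cast
  rfl

lemma isJointType_iff_mulVec_eq {n w : ℕ} {N : 𝓜.Letter → ℕ} (hd : s ∣ n * q) :
    𝓜.IsJointType n w N ↔
      (𝓜.constraintMatrix *ᵥ fun j ↦ (N j : ℤ)) =
        ![(n : ℤ), ((n * q / s : ℕ) : ℤ), (w : ℤ), 0] := by
  rw [constraintMatrix_mulVec_natCast]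
  refine ⟨fun h ↦ by rw [h.vn, h.sum_inr, h.input, h.edge, sub_self], fun h ↦ ?_⟩
  have hc : ∑ c, N (.inr c) = n * q / s := Int.natCast_inj.1 (congrFun h 1)
  exact ⟨Int.natCast_inj.1 (congrFun h 0), by rw [hc, Nat.div_mul_cancel hd],
    Int.natCast_inj.1 (congrFun h 2), Int.natCast_inj.1 (sub_eq_zero.1 (congrFun h 3))⟩

lemma mem_typePolytope_iff {α : ℝ} {r : 𝓜.Letter → ℝ} :
    r ∈ 𝓜.typePolytope α ↔
      0 ≤ r ∧ 𝓜.constraintMatrix.map Int.cast *ᵥ r = (![1, q / s, α, 0] : Fin 4 → ℝ) := by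
  simp only [constraintMatrix_mulVec, typePolytope, typeSpace, inputMean, Set.mem_ofPred_eq]
  refine ⟨fun ⟨⟨h0, hv, hc, he⟩, hα⟩ ↦ ⟨h0, by rw [hv, hc, hα, he, sub_self]⟩, fun ⟨h0, h⟩ ↦ ?_⟩
  exact ⟨⟨h0, congrFun h 0, congrFun h 1, sub_eq_zero.1 (congrFun h 3)⟩, congrFun h 2⟩

lemma convex_typePolytope (α : ℝ) : Convex ℝ (𝓜.typePolytope α) := by
  have h : 𝓜.typePolytope α = Set.Ici 0 ∩
      (𝓜.constraintMatrix.map (Int.cast : ℤ → ℝ)).mulVecLin ⁻¹' {(![1, q / s, α, 0] : Fin 4 → ℝ)} :=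
    Set.ext fun r ↦ 𝓜.mem_typePolytope_iff
  rw [h]
  exact (convex_Ici 0).inter ((convex_singleton _).linear_preimage _)

lemma continuous_inputMean : Continuous 𝓜.inputMean := by
  unfold inputMean
  fun_prop

lemma isClosed_typeSpace : IsClosed 𝓜.typeSpace :=
  isClosed_Ici.inter ((isClosed_eq (by fun_prop) (by fun_prop)).inter
    ((isClosed_eq (by fun_prop) (by fun_prop)).inter (isClosed_eq (by fun_prop) (by fun_prop))))

lemma isCompact_typeSpace : IsCompact 𝓜.typeSpace := by
  refine (isCompact_Icc (a := 0) (b := Sum.elim (fun _ ↦ 1) fun _ ↦ (q / s : ℝ))).of_isClosed_subset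
    𝓜.isClosed_typeSpace ?_
  rintro r ⟨h0, hv, hc, -⟩
  refine ⟨h0, ?_⟩
  rintro (a | c)
  · exact hv ▸ single_le_sum (f := fun a ↦ r (.inl a)) (fun a _ ↦ h0 _) (mem_univ a)
  · exact hc ▸ single_le_sum (f := fun c ↦ r (.inr c)) (fun c _ ↦ h0 _) (mem_univ c)

lemma isCompact_typePolytope (α : ℝ) : IsCompact (𝓜.typePolytope α) :=
  𝓜.isCompact_typeSpace.inter_right (isClosed_eq 𝓜.continuous_inputMean continuous_const)

variable {𝓜} in
lemma IsJointType.div_mem_typePolytope {n w : ℕ} {N : 𝓜.Letter → ℕ} (hn : 0 < n)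
    (h : 𝓜.IsJointType n w N) : (fun j ↦ (N j : ℝ) / n) ∈ 𝓜.typePolytope (w / n) := by
  have hn' : (n : ℝ) ≠ 0 := by positivity
  have hs : (s : ℝ) ≠ 0 := by exact_mod_cast 𝓜.s_pos.ne'
  have hv : ∑ a, (N (.inl a) : ℝ) = n := by exact_mod_cast h.vn
  have hc : (∑ c, (N (.inr c) : ℝ)) * s = n * q := by exact_mod_cast h.cn
  have hi : ∑ a, (N (.inl a) : ℝ) * hammingNorm a = w := by exact_mod_cast h.input
  have he : ∑ a, (N (.inl a) : ℝ) * 𝓜.outWeight a = ∑ c, (N (.inr c) : ℝ) * hammingNorm c.1 := by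
    exact_mod_cast h.edge
  refine ⟨⟨fun j ↦ by positivity, ?_, ?_, ?_⟩, ?_⟩
  · rw [← sum_div, hv, div_self hn']
  · rw [← sum_div, div_eq_div_iff hn' hs, hc, mul_comm]
  · simp only [div_mul_eq_mul_div, ← sum_div, he]
  · simp only [inputMean, div_mul_eq_mul_div, ← sum_div, hi]

/-! ### Existence of the growth rate -/

lemma tendsto_fst_weightFilter (α : ℝ) : Tendsto Prod.fst (𝓜.weightFilter α) atTop :=
  tendsto_comap.mono_left (inf_le_left.trans inf_le_left)

lemma tendsto_div_weightFilter (α : ℝ) :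
    Tendsto (fun x : ℕ × ℕ ↦ (x.2 : ℝ) / x.1) (𝓜.weightFilter α) (𝓝 α) :=
  tendsto_comap.mono_left (inf_le_left.trans inf_le_right)

lemma eventually_dvd_weightFilter (α : ℝ) : ∀ᶠ x in 𝓜.weightFilter α, s ∣ x.1 * q :=
  Eventually.filter_mono inf_le_right (mem_principal_self _)

lemma tendsto_weightFilter {α : ℝ} {n w : ℕ → ℕ} (hd : ∀ᶠ m in atTop, s ∣ n m * q)
    (hn : Tendsto (fun m : ℕ ↦ (n m : ℝ) / m) atTop (𝓝 1))
    (hw : Tendsto (fun m : ℕ ↦ (w m : ℝ) / m) atTop (𝓝 α)) :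
    Tendsto (fun m ↦ (n m, w m)) atTop (𝓜.weightFilter α) := by
  simp only [weightFilter, tendsto_inf, tendsto_comap_iff, tendsto_principal, Function.comp_def]
  refine ⟨⟨?_, ?_⟩, hd⟩
  · have h := hn.pos_mul_atTop one_pos tendsto_natCast_atTop_atTop
    refine (tendsto_natCast_atTop_iff (R := ℝ)).1 (h.congr' ?_)
    filter_upwards [eventually_gt_atTop 0] with m hm
    field_simp
  · have h := hw.div hn one_ne_zero
    rw [div_one] at h
    refine h.congr' ?_
    filter_upwards [eventually_gt_atTop 0] with m hm
    exact div_div_div_cancel_right₀ (by positivity) _ _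

section ExistsGrowthRate

variable {𝓜} {α : ℝ} {r : 𝓜.Letter → ℝ}

lemma eventually_forall_isJointType_div_mem {O : Set (𝓜.Letter → ℝ)} (hO : IsOpen O)
    (hα : 𝓜.typePolytope α ⊆ O) :
    ∀ᶠ x in 𝓜.weightFilter α, ∀ N, 𝓜.IsJointType x.1 x.2 N → (fun j ↦ (N j : ℝ) / x.1) ∈ O := by
  have hK : IsClosed (𝓜.inputMean '' (𝓜.typeSpace \ O)) :=
    ((𝓜.isCompact_typeSpace.diff hO).image 𝓜.continuous_inputMean).isClosed
  have hmem : α ∉ 𝓜.inputMean '' (𝓜.typeSpace \ O) := by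
    rintro ⟨r, ⟨hr, hrO⟩, hrα⟩
    exact hrO (hα ⟨hr, hrα⟩)
  filter_upwards [(𝓜.tendsto_fst_weightFilter α).eventually_gt_atTop 0,
    (𝓜.tendsto_div_weightFilter α).eventually (hK.isOpen_compl.mem_nhds hmem)] with x hn hx N hN
  obtain ⟨hspace, hmean⟩ := hN.div_mem_typePolytope hn
  by_contra hNO
  exact hx ⟨_, ⟨hspace, hNO⟩, hmean⟩

lemma eventually_exists_isJointType_near (hr : r ∈ 𝓜.typePolytope α)
    (hmax : ∀ r' ∈ 𝓜.typePolytope α, r'.support ⊆ r.support) {ε : ℝ} (hε : 0 < ε) :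
    ∀ᶠ x in 𝓜.weightFilter α, ∀ N, 𝓜.IsJointType x.1 x.2 N →
      ∃ N', 𝓜.IsJointType x.1 x.2 N' ∧ ∀ j, |(N' j : ℝ) / x.1 - r j| < ε := by
  obtain ⟨h0, hM⟩ := 𝓜.mem_typePolytope_iff.1 hr
  obtain ⟨δ, hδ, hnear⟩ := exists_nat_mulVec_eq_near 𝓜.constraintMatrix h0 hε
  filter_upwards [(𝓜.tendsto_fst_weightFilter α).eventually hnear,
    eventually_forall_isJointType_div_mem Metric.isOpen_thickening
      (Metric.self_subset_thickening hδ (𝓜.typePolytope α))] with x hx hthick N hN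
  obtain ⟨r₁, hr₁, hdist⟩ := Metric.mem_thickening_iff.1 (hthick N hN)
  obtain ⟨N', hN', hclose⟩ := hx N r₁ (hmax r₁ hr₁)
    ((𝓜.mem_typePolytope_iff.1 hr₁).2.trans hM.symm) fun j ↦ (dist_le_pi_dist _ r₁ j).trans_lt hdist
  refine ⟨N', ?_, hclose⟩
  have hd := hN.dvd
  rw [isJointType_iff_mulVec_eq 𝓜 hd] at hN ⊢
  exact hN'.trans hN

lemma exists_tendsto_isJointType (hr : r ∈ 𝓜.typePolytope α) {p d : ℤ} (hα : d * α = p) :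
    ∃ (N : ℕ → 𝓜.Letter → ℕ) (n w : ℕ → ℕ),
      (∀ᶠ m in atTop, 𝓜.IsJointType (n m) (w m) (N m) ∧ d * w m = p * n m) ∧
      Tendsto (fun m ↦ (n m, w m)) atTop (𝓜.weightFilter α) := by
  obtain ⟨h0, hM⟩ := 𝓜.mem_typePolytope_iff.1 hr
  let H : Matrix (Fin 3) (Fin 4) ℤ := !![-q, s, 0, 0; 0, 0, 0, 1; -p, 0, d, 0]
  have hs : (s : ℝ) ≠ 0 := by exact_mod_cast 𝓜.s_pos.ne'
  have hker : (H * 𝓜.constraintMatrix).map Int.cast *ᵥ r = 0 := by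
    have hmap : (H * 𝓜.constraintMatrix).map (Int.cast : ℤ → ℝ) =
        H.map (Int.cast : ℤ → ℝ) * 𝓜.constraintMatrix.map (Int.cast : ℤ → ℝ) :=
      Matrix.map_mul (f := Int.castRingHom ℝ)
    rw [hmap, ← Matrix.mulVec_mulVec, hM]
    ext d
    fin_cases d <;> simp [H, Matrix.mulVec, dotProduct, Fin.sum_univ_succ, hα, mul_div_cancel₀ _ hs]
  obtain ⟨N, hN, hlim⟩ := exists_tendsto_nat_of_mulVec_eq_zero _ h0 hker
  have htype : ∀ᶠ m in atTop, 𝓜.IsJointType (∑ a, N m (.inl a))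
      (∑ a, N m (.inl a) * hammingNorm a) (N m) ∧
      d * ↑(∑ a, N m (.inl a) * hammingNorm a) = p * ↑(∑ a, N m (.inl a)) := by
    filter_upwards [hN] with m hm
    rw [← Matrix.mulVec_mulVec, constraintMatrix_mulVec_natCast] at hm
    obtain ⟨hc, he, hw⟩ : _ ∧ _ ∧ _ := by
      simpa [H, Matrix.mulVec, dotProduct, Fin.sum_univ_succ, funext_iff, Fin.forall_fin_succ,
        -Nat.cast_sum] using hm
    exact ⟨⟨rfl, by exact_mod_cast (neg_add_eq_zero.1 hc).symm, rfl,
      by exact_mod_cast sub_eq_zero.1 he⟩, by linarith⟩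
  have hv : Tendsto (fun m : ℕ ↦ ((∑ a, N m (.inl a) : ℕ) : ℝ) / m) atTop (𝓝 1) := by
    simp only [← hr.1.2.1, Nat.cast_sum, sum_div]
    exact tendsto_finsetSum _ fun a _ ↦ hlim _
  have hw : Tendsto (fun m : ℕ ↦ ((∑ a, N m (.inl a) * hammingNorm a : ℕ) : ℝ) / m) atTop
      (𝓝 α) := by
    simp only [← hr.2, inputMean, Nat.cast_sum, Nat.cast_mul, sum_div, mul_div_right_comm]
    exact tendsto_finsetSum _ fun a _ ↦ (hlim _).mul_const _
  exact ⟨N, _, _, htype, 𝓜.tendsto_weightFilter (htype.mono fun m hm ↦ hm.1.dvd) hv hw⟩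

lemma eventually_expNumCodewords_eq_zero (h : 𝓜.typePolytope α = ∅) :
    ∀ᶠ x in 𝓜.weightFilter α, 𝓜.expNumCodewords x.1 x.2 = 0 := by
  filter_upwards [eventually_forall_isJointType_div_mem isOpen_empty h.subset,
    𝓜.eventually_dvd_weightFilter α] with x hx hd
  by_contra hne
  have h0 : 0 ≤ 𝓜.expNumCodewords x.1 x.2 := by
    rw [expNumCodewords]
    positivity
  obtain ⟨N, hN⟩ := exists_isJointType_of_expNumCodewords_pos hd (h0.lt_of_ne' hne)
  exact hx N hN

lemma frequently_expNumCodewords_pos (hr : r ∈ 𝓜.typePolytope α) :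
    ∃ᶠ x in 𝓜.weightFilter α, 0 < 𝓜.expNumCodewords x.1 x.2 := by
  obtain ⟨N, n, w, hN, hlim⟩ := exists_tendsto_isJointType hr (p := 0) (d := 0) (by simp)
  exact hlim.frequently (hN.mono fun m hm ↦ hm.1.expNumCodewords_pos).frequently

lemma frequently_expNumCodewords_pos_of_rat {a : ℚ} (hr : r ∈ 𝓜.typePolytope a) :
    ∃ᶠ n : ℕ in atTop, s ∣ n * q ∧ ∃ w : ℕ, (w : ℝ) = a * n ∧ 0 < 𝓜.expNumCodewords n w := by
  have hden : (a.den : ℝ) ≠ 0 := by exact_mod_cast a.den_ne_zero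
  have ha : (a.den : ℝ) * a = a.num := by exact_mod_cast a.den_mul_eq_num
  obtain ⟨N, n, w, hN, hlim⟩ := exists_tendsto_isJointType hr (p := a.num) (d := a.den)
    (by exact_mod_cast ha)
  refine ((𝓜.tendsto_fst_weightFilter a).comp hlim).frequently (hN.mono ?_).frequently
  rintro m ⟨hm, hw⟩
  refine ⟨hm.dvd, w m, ?_, hm.expNumCodewords_pos⟩
  have hw' : (a.den : ℝ) * w m = a.num * n m := by exact_mod_cast hw
  rw [← mul_right_inj' hden, hw', ← ha, mul_assoc]
  rfl

lemma eventually_lt_log_expNumCodewords_div {b : ℝ} (hr : r ∈ 𝓜.typePolytope α)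
    (hb : b < 𝓜.exponent r) :
    ∀ᶠ x in 𝓜.weightFilter α, 0 < 𝓜.expNumCodewords x.1 x.2 →
      b < log (𝓜.expNumCodewords x.1 x.2) / x.1 := by
  obtain ⟨b', hbb', hb'⟩ := exists_between hb
  obtain ⟨r₁, hr₁, hmax, hexp⟩ := exists_maximal_support_of_lt (𝓜.convex_typePolytope α)
    (fun r hr ↦ hr.1.1) 𝓜.continuous_exponent hr hb'
  obtain ⟨ε, hε, hball⟩ := Metric.isOpen_iff.1 (isOpen_Ioi.preimage 𝓜.continuous_exponent) r₁ hexp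
  have hfst := 𝓜.tendsto_fst_weightFilter α
  filter_upwards [eventually_exists_isJointType_near hr₁ hmax hε, hfst.eventually_gt_atTop 0,
    hfst.eventually (𝓜.tendsto_logError_div.eventually_lt_const (sub_pos.2 hbb')),
    𝓜.eventually_dvd_weightFilter α] with x hnear hn herr hd hpos
  obtain ⟨N, hN⟩ := exists_isJointType_of_expNumCodewords_pos hd hpos
  obtain ⟨N', hN', hclose⟩ := hnear N hN
  have hn' : (0 : ℝ) < x.1 := by exact_mod_cast hn
  have hlt : b' < 𝓜.exponent fun j ↦ (N' j : ℝ) / x.1 :=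
    hball ((dist_pi_lt_iff hε).2 hclose)
  have hle := hN'.le_log_expNumCodewords hn
  rw [div_lt_iff₀ hn'] at herr
  rw [lt_div_iff₀ hn']
  nlinarith

lemma eventually_log_expNumCodewords_div_lt {b : ℝ}
    (hb : ∀ r ∈ 𝓜.typePolytope α, 𝓜.exponent r ≤ b) {b' : ℝ} (hbb' : b < b') :
    ∀ᶠ x in 𝓜.weightFilter α, 0 < 𝓜.expNumCodewords x.1 x.2 →
      log (𝓜.expNumCodewords x.1 x.2) / x.1 < b' := by
  obtain ⟨c, hbc, hcb'⟩ := exists_between hbb'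
  have hfst := 𝓜.tendsto_fst_weightFilter α
  filter_upwards [eventually_forall_isJointType_div_mem
      (isOpen_Iio.preimage 𝓜.continuous_exponent) fun r hr ↦ (hb r hr).trans_lt hbc,
    hfst.eventually_gt_atTop 0,
    hfst.eventually (𝓜.tendsto_logError_div.eventually_lt_const (sub_pos.2 hcb')),
    𝓜.eventually_dvd_weightFilter α] with x hx hn herr hd hpos
  have hn' : (0 : ℝ) < x.1 := by exact_mod_cast hn
  have hle := log_expNumCodewords_le hn hd hpos fun N hN ↦ (hx N hN).le
  rw [div_lt_iff₀ hn'] at herr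
  rw [div_lt_iff₀ hn']
  linarith

lemma hasGrowthRate_of_isGreatest {g : ℝ} (hg : IsGreatest (𝓜.exponent '' 𝓜.typePolytope α) g) :
    𝓜.HasGrowthRate α g := by
  obtain ⟨⟨r, hr, rfl⟩, hub⟩ := hg
  refine ⟨frequently_expNumCodewords_pos hr, ?_, ?_⟩
  · rintro ⟨a, rfl⟩
    exact frequently_expNumCodewords_pos_of_rat hr
  · simp only [one_div_mul_eq_div]
    refine tendsto_order.2 ⟨fun b hb ↦ eventually_inf_principal.2 ?_,
      fun b hb ↦ eventually_inf_principal.2 ?_⟩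
    · exact eventually_lt_log_expNumCodewords_div hr hb
    · exact eventually_log_expNumCodewords_div_lt (fun r' hr' ↦ hub ⟨r', hr', rfl⟩) hb

end ExistsGrowthRate

end StronglyRegularEnsemble

/-! ### Logarithmic derivatives of generating functions -/

section GeneratingFunction

variable {S : Type*} [Fintype S]

lemma mean_single [DecidableEq S] (f : S → ℝ) (a : S) : mean f (Pi.single a 1) = f a := by
  simp [mean_apply, Pi.single_apply]

lemma mean_mul_add_mul (f g : S → ℝ) (x y : ℝ) (p : S → ℝ) :
    mean (fun a ↦ f a * x + g a * y) p = mean f p * x + mean g p * y := by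
  simp only [mean_apply, mul_add, ← mul_assoc, sum_add_distrib, ← sum_mul]

lemma exp_add_natCast_mul_log (t : ℝ) (n : ℕ) {x : ℝ} (hx : 0 < x) :
    exp (t + n * log x) = exp t * x ^ n := by
  rw [exp_add, exp_nat_mul, exp_log hx]

lemma hasDerivAt_pow_mul_self (n : ℕ) {x : ℝ} (hx : x ≠ 0) :
    HasDerivAt (fun t ↦ t ^ n) (x ^ n * n / x) x := by
  have h : x ^ n * n / x = n * x ^ (n - 1) := by
    rcases n with _ | n
    · simp
    · rw [Nat.add_sub_cancel, pow_succ]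
      field_simp
  rw [h]
  exact hasDerivAt_pow n x

lemma deriv_div_mul_eq_mean_softmax (θ : S → ℝ) (n : S → ℕ) {x : ℝ} (hx : 0 < x) :
    deriv (fun t ↦ ∑ a, exp (θ a) * t ^ n a) x / (∑ a, exp (θ a) * x ^ n a) * x =
      mean (fun a ↦ n a) (softmax fun a ↦ θ a + n a * log x) := by
  have hderiv := HasDerivAt.fun_sum fun a (_ : a ∈ univ) ↦
    (hasDerivAt_pow_mul_self (n a) hx.ne').const_mul (exp (θ a))
  simp only [hderiv.deriv, mean_apply, softmax, exp_add_natCast_mul_log _ _ hx, sum_div, sum_mul]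
  refine sum_congr rfl fun a _ ↦ ?_
  field_simp

lemma existsUnique_pos_log {P : ℝ → Prop} (h : ∃! θ, P θ) : ∃! x, 0 < x ∧ P (log x) := by
  obtain ⟨θ, hθ, huniq⟩ := h
  refine ⟨exp θ, ⟨exp_pos θ, by rwa [log_exp]⟩, fun x ⟨hx, hPx⟩ ↦ ?_⟩
  rw [← huniq _ hPx, exp_log hx]

lemma existsUnique_pos_log₂ {P : ℝ → ℝ → Prop} (h : ∃! θ : ℝ × ℝ, P θ.1 θ.2) :
    ∃! p : ℝ × ℝ, 0 < p.1 ∧ 0 < p.2 ∧ P (log p.1) (log p.2) := by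
  obtain ⟨θ, hθ, huniq⟩ := h
  refine ⟨(exp θ.1, exp θ.2), ⟨exp_pos _, exp_pos _, by rwa [log_exp, log_exp]⟩, ?_⟩
  rintro p ⟨h₁, h₂, hp⟩
  rw [← huniq (log p.1, log p.2) hp, exp_log h₁, exp_log h₂]

end GeneratingFunction

/-! ### The range of the mean local codeword weight of a VN -/

/-- The probability distributions of local input words of length `k` with mean weight `α`. -/
def inputLaws (k : ℕ) (α : ℝ) : Set ((Fin k → ZMod 2) → ℝ) :=
  {p ∈ stdSimplex ℝ (Fin k → ZMod 2) | mean (fun a ↦ (hammingNorm a : ℝ)) p = α}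

/-- The masses that `p` gives to the nonzero weights, indexed as in `feasible`. -/
def weightMass {k : ℕ} (p : (Fin k → ZMod 2) → ℝ) (i : Fin k) : ℝ :=
  ∑ a with hammingNorm a = (i : ℕ) + 1, p a

section InputLaws

variable {k : ℕ} {α : ℝ} {p : (Fin k → ZMod 2) → ℝ}

lemma isCompact_inputLaws : IsCompact (inputLaws k α) :=
  (isCompact_stdSimplex ℝ _).inter_right (isClosed_eq (mean _).continuous continuous_const)

lemma convex_inputLaws : Convex ℝ (inputLaws k α) :=
  (convex_stdSimplex ℝ _).inter ((convex_singleton α).linear_preimage (mean _).toLinearMap)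

lemma hammingNorm_one : hammingNorm (1 : Fin k → ZMod 2) = k := by
  simp [hammingNorm]

lemma exists_hammingNorm_eq {i : ℕ} (hi : i ≤ k) : ∃ a : Fin k → ZMod 2, hammingNorm a = i := by
  obtain ⟨t, -, ht⟩ := exists_subset_card_eq (s := (univ : Finset (Fin k))) (by simpa using hi)
  exact ⟨fun j ↦ if j ∈ t then 1 else 0, by simp [hammingNorm, ht]⟩

lemma inputLaws_nonempty (h₀ : 0 ≤ α) (h₁ : α ≤ k) : (inputLaws k α).Nonempty := by
  have hle (a : Fin k → ZMod 2) : hammingNorm a ≤ hammingNorm (1 : Fin k → ZMod 2) := by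
    rw [hammingNorm_one]
    simpa using hammingNorm_le_card_fintype (x := a)
  have himage := image_mean_stdSimplex (f := fun a : Fin k → ZMod 2 ↦ (hammingNorm a : ℝ))
    (a₀ := 0) (a₁ := 1) (fun a ↦ by simp) fun a ↦ by exact_mod_cast hle a
  rw [hammingNorm_zero, Nat.cast_zero, hammingNorm_one] at himage
  obtain ⟨p, hp, hpα⟩ := himage.ge ⟨h₀, h₁⟩
  exact ⟨p, hp, hpα⟩

lemma sum_mul_comp_hammingNorm (p : (Fin k → ZMod 2) → ℝ) (f : ℕ → ℝ) :
    ∑ a, p a * f (hammingNorm a) =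
      p 0 * f 0 + ∑ i : Fin k, f ((i : ℕ) + 1) * weightMass p i := by
  have hmaps (a : Fin k → ZMod 2) (_ : a ∈ univ) : hammingNorm a ∈ range (k + 1) := by
    simpa [Nat.lt_succ_iff] using hammingNorm_le_card_fintype (x := a)
  have hfiber (i : ℕ) : ∑ a with hammingNorm a = i, p a * f (hammingNorm a) =
      f i * ∑ a : Fin k → ZMod 2 with hammingNorm a = i, p a := by
    rw [mul_sum]
    refine sum_congr rfl fun a ha ↦ ?_
    rw [(mem_filter.1 ha).2, mul_comm]
  rw [← sum_fiberwise_of_maps_to hmaps, sum_range_succ', add_comm, sum_range]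
  simp only [hfiber, weightMass]
  simp [filter_eq', mul_comm]

lemma weightMass_mem_feasible {q s : ℕ} (𝓜 : StronglyRegularEnsemble k q s)
    (hp : p ∈ inputLaws k α) : weightMass p ∈ 𝓜.feasible α := by
  obtain ⟨⟨h0, h1⟩, hα⟩ := hp
  have hmass := sum_mul_comp_hammingNorm p fun _ ↦ 1
  have hmean := sum_mul_comp_hammingNorm p fun i ↦ (i : ℝ)
  simp only [mul_one, one_mul, h1] at hmass
  rw [← mean_apply, hα, Nat.cast_zero, mul_zero, zero_add] at hmean
  refine ⟨fun i ↦ sum_nonneg fun a _ ↦ h0 a, by linarith [h0 0], ?_⟩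
  rw [hmean]
  push_cast
  rfl

end InputLaws

namespace StronglyRegularEnsemble

variable {k q s : ℕ} (𝓜 : StronglyRegularEnsemble k q s)

section VariableNode

variable {α β x y : ℝ} {p : (Fin k → ZMod 2) → ℝ}

lemma outWeight_zero : 𝓜.outWeight 0 = 0 := by simp [outWeight]

lemma outWeight_pos {a : Fin k → ZMod 2} (ha : a ≠ 0) : 0 < 𝓜.outWeight a := by
  refine hammingNorm_pos_iff.2 fun h ↦ ha ?_
  have hinj := Matrix.vecMul_injective_iff.2 𝓜.vnRep_linearIndependent
  exact hinj (h.trans (Matrix.zero_vecMul _).symm)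

lemma setOf_ioCoeff_pos (i : ℕ) : {j | 0 < ioCoeff 𝓜.vnRep i j} =
    𝓜.outWeight '' {a : Fin k → ZMod 2 | hammingNorm a = i} := by
  ext j
  simp [ioCoeff, outWeight, Fintype.card_pos_iff]

lemma U_le_outWeight (a : Fin k → ZMod 2) : 𝓜.U (hammingNorm a) ≤ 𝓜.outWeight a := by
  rw [U, setOf_ioCoeff_pos]
  exact Nat.sInf_le ⟨a, rfl, rfl⟩

lemma outWeight_le_V (a : Fin k → ZMod 2) : 𝓜.outWeight a ≤ 𝓜.V (hammingNorm a) := by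
  rw [V, setOf_ioCoeff_pos]
  exact le_csSup (Set.toFinite _).bddAbove ⟨a, rfl, rfl⟩

lemma exists_outWeight_eq_U {i : ℕ} (hi : i ≤ k) :
    ∃ a : Fin k → ZMod 2, hammingNorm a = i ∧ 𝓜.outWeight a = 𝓜.U i := by
  obtain ⟨a, ha⟩ := exists_hammingNorm_eq hi
  rw [U, setOf_ioCoeff_pos]
  exact Nat.sInf_mem (s := 𝓜.outWeight '' {a : Fin k → ZMod 2 | hammingNorm a = i}) ⟨_, a, ha, rfl⟩

lemma exists_outWeight_eq_V {i : ℕ} (hi : i ≤ k) :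
    ∃ a : Fin k → ZMod 2, hammingNorm a = i ∧ 𝓜.outWeight a = 𝓜.V i := by
  obtain ⟨a, ha⟩ := exists_hammingNorm_eq hi
  rw [V, setOf_ioCoeff_pos]
  exact Nat.sSup_mem (s := 𝓜.outWeight '' {a : Fin k → ZMod 2 | hammingNorm a = i}) ⟨_, a, ha, rfl⟩
    (Set.toFinite _).bddAbove

lemma U_zero : 𝓜.U 0 = 0 := by
  have h := 𝓜.U_le_outWeight 0
  rwa [hammingNorm_zero, outWeight_zero, Nat.le_zero] at h

lemma V_zero : 𝓜.V 0 = 0 := by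
  obtain ⟨a, ha, hV⟩ := 𝓜.exists_outWeight_eq_V (Nat.zero_le k)
  rw [← hV, hammingNorm_eq_zero.1 ha, outWeight_zero]

/-- The mean weight of the local codeword of a VN whose input word has distribution `p`. -/
noncomputable def outMean : ((Fin k → ZMod 2) → ℝ) →L[ℝ] ℝ := mean fun a ↦ (𝓜.outWeight a : ℝ)

lemma sum_U_mul_weightMass_le (hp : 0 ≤ p) :
    ∑ i : Fin k, (𝓜.U (i + 1) : ℝ) * weightMass p i ≤ 𝓜.outMean p := by
  have h := sum_mul_comp_hammingNorm p fun i ↦ (𝓜.U i : ℝ)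
  rw [U_zero, Nat.cast_zero, mul_zero, zero_add] at h
  rw [← h, outMean, mean_apply]
  exact sum_le_sum fun a _ ↦
    mul_le_mul_of_nonneg_left (by exact_mod_cast 𝓜.U_le_outWeight a) (hp a)

lemma le_sum_V_mul_weightMass (hp : 0 ≤ p) :
    𝓜.outMean p ≤ ∑ i : Fin k, (𝓜.V (i + 1) : ℝ) * weightMass p i := by
  have h := sum_mul_comp_hammingNorm p fun i ↦ (𝓜.V i : ℝ)
  rw [V_zero, Nat.cast_zero, mul_zero, zero_add] at h
  rw [← h, outMean, mean_apply]
  exact sum_le_sum fun a _ ↦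
    mul_le_mul_of_nonneg_left (by exact_mod_cast 𝓜.outWeight_le_V a) (hp a)

lemma image_feasible_subset {W : ℕ → ℕ}
    (hW : ∀ i ≤ k, ∃ a : Fin k → ZMod 2, hammingNorm a = i ∧ 𝓜.outWeight a = W i) :
    (fun ω : Fin k → ℝ ↦ ∑ i : Fin k, (W (i + 1) : ℝ) * ω i) '' 𝓜.feasible α ⊆
      𝓜.outMean '' inputLaws k α := by
  rintro _ ⟨ω, ⟨h0, h1, hα⟩, rfl⟩
  choose b hb hbW using fun i : Fin k ↦ hW (i + 1) i.2
  let p : (Fin k → ZMod 2) → ℝ :=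
    (1 - ∑ i, ω i) • Pi.single 0 1 + ∑ i, ω i • Pi.single (b i) 1
  have hp0 : 0 ≤ p := add_nonneg
    (smul_nonneg (sub_nonneg.2 h1) (Pi.single_nonneg.2 zero_le_one))
    (sum_nonneg fun i _ ↦ smul_nonneg (h0 i) (Pi.single_nonneg.2 zero_le_one))
  have hmean (f : (Fin k → ZMod 2) → ℝ) :
      mean f p = (1 - ∑ i, ω i) * f 0 + ∑ i, ω i * f (b i) := by
    simp only [p, map_add, map_sum, map_smul, mean_single, smul_eq_mul]
  refine ⟨p, ⟨⟨hp0, ?_⟩, ?_⟩, ?_⟩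
  · simpa [mean_apply] using hmean 1
  · rw [hmean, ← hα]
    simp [hb, mul_comm]
  · rw [outMean, hmean]
    simp [hbW, outWeight_zero, mul_comm]

lemma bddBelow_image_inputLaws : BddBelow (𝓜.outMean '' inputLaws k α) :=
  (isCompact_inputLaws.image 𝓜.outMean.continuous).bddBelow

lemma bddAbove_image_inputLaws : BddAbove (𝓜.outMean '' inputLaws k α) :=
  (isCompact_inputLaws.image 𝓜.outMean.continuous).bddAbove

lemma lower_eq_sInf (h : (inputLaws k α).Nonempty) :
    𝓜.lower α = sInf (𝓜.outMean '' inputLaws k α) := by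
  have hsub := 𝓜.image_feasible_subset (α := α) fun i ↦ 𝓜.exists_outWeight_eq_U
  refine le_antisymm (le_csInf (h.image _) ?_) (csInf_le_csInf 𝓜.bddBelow_image_inputLaws
    (h.elim fun p hp ↦ ⟨_, _, weightMass_mem_feasible 𝓜 hp, rfl⟩) hsub)
  rintro _ ⟨p, hp, rfl⟩
  exact (csInf_le (𝓜.bddBelow_image_inputLaws.mono hsub)
    ⟨_, weightMass_mem_feasible 𝓜 hp, rfl⟩).trans (𝓜.sum_U_mul_weightMass_le hp.1.1)

lemma upper_eq_sSup (h : (inputLaws k α).Nonempty) :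
    𝓜.upper α = sSup (𝓜.outMean '' inputLaws k α) := by
  have hsub := 𝓜.image_feasible_subset (α := α) fun i ↦ 𝓜.exists_outWeight_eq_V
  refine le_antisymm (csSup_le_csSup 𝓜.bddAbove_image_inputLaws
    (h.elim fun p hp ↦ ⟨_, _, weightMass_mem_feasible 𝓜 hp, rfl⟩) hsub) (csSup_le (h.image _) ?_)
  rintro _ ⟨p, hp, rfl⟩
  exact (𝓜.le_sum_V_mul_weightMass hp.1.1).trans (le_csSup (𝓜.bddAbove_image_inputLaws.mono hsub)
    ⟨_, weightMass_mem_feasible 𝓜 hp, rfl⟩)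

lemma image_outMean_inputLaws (h₀ : 0 ≤ α) (h₁ : α ≤ k) :
    𝓜.outMean '' inputLaws k α = Set.Icc (𝓜.lower α) (𝓜.upper α) := by
  have hne := inputLaws_nonempty h₀ h₁
  rw [𝓜.lower_eq_sInf hne, 𝓜.upper_eq_sSup hne]
  exact eq_Icc_of_connected_compact
    ⟨hne.image _, convex_inputLaws.isPreconnected.image _ 𝓜.outMean.continuous.continuousOn⟩
    (isCompact_inputLaws.image 𝓜.outMean.continuous)

lemma outMean_pos (h₀ : 0 < α) (hp : p ∈ inputLaws k α) : 0 < 𝓜.outMean p := by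
  have hmean : ∑ a, p a * hammingNorm a ≠ 0 := by
    rw [← mean_apply, hp.2]
    exact h₀.ne'
  obtain ⟨a, -, ha⟩ := exists_ne_zero_of_sum_ne_zero hmean
  have ha0 : a ≠ 0 := hammingNorm_ne_zero_iff.1 (Nat.cast_ne_zero.1 (right_ne_zero_of_mul ha))
  have hpa : 0 < p a := (hp.1.1 a).lt_of_ne' (left_ne_zero_of_mul ha)
  rw [outMean, mean_apply]
  exact sum_pos' (fun b _ ↦ mul_nonneg (hp.1.1 b) (Nat.cast_nonneg _))
    ⟨a, mem_univ a, mul_pos hpa (by exact_mod_cast 𝓜.outWeight_pos ha0)⟩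

/-! ### The VN saddle-point equations -/

/-- The distribution of local input words proportional to the terms of `B(x, y)`. -/
noncomputable def vnLaw (x y : ℝ) : (Fin k → ZMod 2) → ℝ :=
  softmax fun a ↦ hammingNorm a * log x + 𝓜.outWeight a * log y

lemma B_eq_sum (x y : ℝ) :
    𝓜.B x y = ∑ a : Fin k → ZMod 2, x ^ hammingNorm a * y ^ 𝓜.outWeight a :=
  ioWef_eq_sum _ x y

lemma B_eq_sum_exp (hx : 0 < x) (hy : 0 < y) : 𝓜.B x y =
    ∑ a : Fin k → ZMod 2, exp (hammingNorm a * log x + 𝓜.outWeight a * log y) := by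
  simp only [B_eq_sum, exp_add_natCast_mul_log _ _ hy, exp_nat_mul, exp_log hx]

lemma deriv_B_fst_div_mul (hx : 0 < x) (hy : 0 < y) :
    deriv (fun t ↦ 𝓜.B t y) x / 𝓜.B x y * x =
      mean (fun a ↦ (hammingNorm a : ℝ)) (𝓜.vnLaw x y) := by
  have hB (t : ℝ) : 𝓜.B t y = ∑ a : Fin k → ZMod 2,
      exp (𝓜.outWeight a * log y) * t ^ hammingNorm a := by
    simp only [B_eq_sum, exp_nat_mul, exp_log hy]
    exact sum_congr rfl fun a _ ↦ mul_comm _ _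
  simp only [hB, deriv_div_mul_eq_mean_softmax _ _ hx, vnLaw, add_comm]

lemma deriv_B_snd_div_mul (hx : 0 < x) (hy : 0 < y) :
    deriv (fun t ↦ 𝓜.B x t) y / 𝓜.B x y * y = 𝓜.outMean (𝓜.vnLaw x y) := by
  have hB (t : ℝ) : 𝓜.B x t = ∑ a : Fin k → ZMod 2,
      exp (hammingNorm a * log x) * t ^ 𝓜.outWeight a := by
    simp only [B_eq_sum, exp_nat_mul, exp_log hx]
  simp only [hB, deriv_div_mul_eq_mean_softmax _ _ hy, vnLaw, outMean]

lemma isVNSaddle_iff : 𝓜.IsVNSaddle α β x y ↔ 0 < x ∧ 0 < y ∧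
    mean (fun a ↦ (hammingNorm a : ℝ)) (𝓜.vnLaw x y) = α ∧ 𝓜.outMean (𝓜.vnLaw x y) = β :=
  and_congr_right fun hx ↦ and_congr_right fun hy ↦ by
    rw [deriv_B_fst_div_mul 𝓜 hx hy, deriv_B_snd_div_mul 𝓜 hx hy]

lemma exists_lt_of_mem_Ioo (h₀ : 0 < α) (h₁ : α < k)
    (hβ : β ∈ Set.Ioo (𝓜.lower α) (𝓜.upper α)) {d : ℝ × ℝ} (hd : d ≠ 0) :
    ∃ a : Fin k → ZMod 2, α * d.1 + β * d.2 < hammingNorm a * d.1 + 𝓜.outWeight a * d.2 := by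
  have himage := 𝓜.image_outMean_inputLaws h₀.le h₁.le
  have hle := (hβ.1.trans hβ.2).le
  have hlaw : (∃ p ∈ inputLaws k α, β * d.2 < 𝓜.outMean p * d.2) →
      ∃ a : Fin k → ZMod 2, α * d.1 + β * d.2 < hammingNorm a * d.1 + 𝓜.outWeight a * d.2 := by
    rintro ⟨p, hp, hlt⟩
    refine exists_lt_of_lt_mean hp.1 ?_
    rw [mean_mul_add_mul, hp.2]
    exact add_lt_add_right hlt _
  rcases lt_trichotomy d.2 0 with h | h | h
  · obtain ⟨p, hp, hpe⟩ := himage.ge (Set.left_mem_Icc.2 hle)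
    exact hlaw ⟨p, hp, mul_lt_mul_of_neg_right (hpe ▸ hβ.1) h⟩
  · have hd' : d.1 ≠ 0 := fun h' ↦ hd (Prod.ext h' h)
    rcases lt_or_gt_of_ne hd' with h' | h'
    · exact ⟨0, by simpa [h] using mul_neg_of_pos_of_neg h₀ h'⟩
    · exact ⟨1, by simpa [h, hammingNorm_one] using mul_lt_mul_of_pos_right h₁ h'⟩
  · obtain ⟨p, hp, hpe⟩ := himage.ge (Set.right_mem_Icc.2 hle)
    exact hlaw ⟨p, hp, mul_lt_mul_of_pos_right (hpe ▸ hβ.2) h⟩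

lemma existsUnique_isVNSaddle (h₀ : 0 < α) (h₁ : α < k)
    (hβ : β ∈ Set.Ioo (𝓜.lower α) (𝓜.upper α)) :
    ∃! p : ℝ × ℝ, 𝓜.IsVNSaddle α β p.1 p.2 := by
  simp only [isVNSaddle_iff]
  exact existsUnique_pos_log₂ (P := fun t u ↦
    mean (fun a ↦ (hammingNorm a : ℝ)) (softmax fun a : Fin k → ZMod 2 ↦
      hammingNorm a * t + 𝓜.outWeight a * u) = α ∧
    𝓜.outMean (softmax fun a ↦ hammingNorm a * t + 𝓜.outWeight a * u) = β)
    (existsUnique_mean_softmax_eq₂ fun d hd ↦ 𝓜.exists_lt_of_mem_Ioo h₀ h₁ hβ hd)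

lemma exists_isVNSaddle_of_lower_eq_upper (h₀ : 0 < α) (h₁ : α < k)
    (heq : 𝓜.lower α = 𝓜.upper α) : ∃ p : ℝ × ℝ, 𝓜.IsVNSaddle α (𝓜.lower α) p.1 p.2 := by
  obtain ⟨θ, hθ, -⟩ := existsUnique_mean_softmax_eq
    (f := fun a : Fin k → ZMod 2 ↦ (hammingNorm a : ℝ)) (b := α) ⟨0, by simpa⟩
    ⟨1, by simpa [hammingNorm_one]⟩
  have hlaw : 𝓜.vnLaw (exp θ) 1 = softmax fun a ↦ hammingNorm a * θ := by simp [vnLaw]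
  rw [← hlaw] at hθ
  have hmem : 𝓜.outMean (𝓜.vnLaw (exp θ) 1) ∈ Set.Icc (𝓜.lower α) (𝓜.upper α) := by
    rw [← 𝓜.image_outMean_inputLaws h₀.le h₁.le]
    exact ⟨_, ⟨softmax_mem_stdSimplex _, hθ⟩, rfl⟩
  rw [← heq, Set.Icc_self] at hmem
  exact ⟨(exp θ, 1), 𝓜.isVNSaddle_iff.2 ⟨exp_pos θ, one_pos, hθ, hmem⟩⟩

/-- The VN term `X(β)` of the growth rate, as the maximal exponent of the number of choices of
local input words with mean weight `α` and mean local codeword weight `β`. -/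
noncomputable def vnTerm (α β : ℝ) : ℝ := sliceSup (inputLaws k α) 𝓜.outMean multinomialExponent β

lemma isVNTerm_vnTerm (h₀ : 0 ≤ α) (h₁ : α ≤ k) : 𝓜.IsVNTerm α (𝓜.vnTerm α) := by
  rw [IsVNTerm, ← 𝓜.image_outMean_inputLaws h₀ h₁]
  refine ⟨continuousOn_sliceSup isCompact_inputLaws convex_inputLaws continuous_multinomialExponent,
    fun β hβ x y hxy ↦ ?_⟩
  obtain ⟨hx, hy, hα, hβ'⟩ := 𝓜.isVNSaddle_iff.1 hxy
  have hmax : IsGreatest (multinomialExponent '' {p ∈ inputLaws k α | 𝓜.outMean p = β})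
      (log (𝓜.B x y) - (α * log x + β * log y)) := by
    rw [𝓜.B_eq_sum_exp hx hy]
    refine isGreatest_multinomialExponent_softmax _ (fun p hp ↦ hp.1.1) (fun p hp ↦ ?_)
      ⟨⟨softmax_mem_stdSimplex _, hα⟩, hβ'⟩
    rw [mean_mul_add_mul, hp.1.2, ← hp.2, outMean]
  have hB : 𝓜.B x y ≠ 0 := by rw [𝓜.B_eq_sum_exp hx hy]; exact (sum_exp_pos _).ne'
  rw [vnTerm, (isGreatest_sliceSup isCompact_inputLaws continuous_multinomialExponent hβ).unique
    hmax, log_div hB (by positivity), log_mul (by positivity) (by positivity), log_rpow hx,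
    log_rpow hy]

end VariableNode

/-! ### The CN saddle-point equation -/

section CheckNode

variable {β z : ℝ}

lemma q_pos (𝓜 : StronglyRegularEnsemble k q s) (hk : 0 < k) : 0 < q := by
  have : NeZero k := ⟨hk.ne'⟩
  exact (𝓜.outWeight_pos one_ne_zero).trans_le (𝓜.outWeight_le 1)

lemma intLambda_eq (hq : 0 < q) : 𝓜.intLambda = 1 / q := by
  simp [intLambda, integral_pow, Nat.cast_sub (Nat.one_le_of_lt hq)]

lemma intRho_eq : 𝓜.intRho = 1 / s := by
  simp [intRho, integral_pow, Nat.cast_sub (Nat.one_le_of_lt 𝓜.s_pos)]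

lemma intLambda_div_intRho (hq : 0 < q) : 𝓜.intLambda / 𝓜.intRho = s / q := by
  rw [𝓜.intLambda_eq hq, intRho_eq, div_div_div_cancel_left' _ _ one_ne_zero]

lemma A_eq_sum (z : ℝ) : 𝓜.A z = ∑ c : 𝓜.cnRep, z ^ hammingNorm c.1 :=
  wef_eq_sum _ z

lemma setOf_wefCoeff_pos :
    {u | 0 < wefCoeff 𝓜.cnRep u} = Set.range fun c : 𝓜.cnRep ↦ hammingNorm c.1 := by
  ext u
  simp [wefCoeff, Nat.card_pos_iff, nonempty_subtype, Subtype.finite]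

lemma hammingNorm_le_cnMaxWeight (c : 𝓜.cnRep) : hammingNorm c.1 ≤ 𝓜.cnMaxWeight := by
  rw [cnMaxWeight, setOf_wefCoeff_pos]
  exact le_csSup (Set.toFinite _).bddAbove ⟨c, rfl⟩

lemma exists_hammingNorm_eq_cnMaxWeight : ∃ c : 𝓜.cnRep, hammingNorm c.1 = 𝓜.cnMaxWeight := by
  rw [cnMaxWeight, setOf_wefCoeff_pos]
  exact Nat.sSup_mem (Set.range_nonempty _) (Set.toFinite _).bddAbove

/-- The mean weight of a CN codeword with distribution `t`. -/
noncomputable def cnMean : (𝓜.cnRep → ℝ) →L[ℝ] ℝ := mean fun c ↦ (hammingNorm c.1 : ℝ)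

lemma image_cnMean_stdSimplex :
    𝓜.cnMean '' stdSimplex ℝ 𝓜.cnRep = Set.Icc 0 (𝓜.cnMaxWeight : ℝ) := by
  obtain ⟨c, hc⟩ := 𝓜.exists_hammingNorm_eq_cnMaxWeight
  have h := image_mean_stdSimplex (f := fun c : 𝓜.cnRep ↦ (hammingNorm c.1 : ℝ))
    (a₀ := 0) (a₁ := c) (fun a ↦ by simp)
    fun a ↦ by exact_mod_cast hc ▸ 𝓜.hammingNorm_le_cnMaxWeight a
  simpa only [hc, ZeroMemClass.coe_zero, hammingNorm_zero, Nat.cast_zero, cnMean] using h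

lemma mem_cnRange_iff (hq : 0 < q) :
    β ∈ 𝓜.cnRange ↔ 0 < β ∧ β * (s / q) ∈ 𝓜.cnMean '' stdSimplex ℝ 𝓜.cnRep := by
  rw [cnRange, Set.mem_ofPred_eq, 𝓜.intLambda_div_intRho hq, image_cnMean_stdSimplex]
  exact and_congr_right fun h ↦ (and_iff_right (by positivity)).symm

/-- The distribution of CN codewords proportional to the terms of `A(z)`. -/
noncomputable def cnLaw (z : ℝ) : 𝓜.cnRep → ℝ := softmax fun c ↦ hammingNorm c.1 * log z

lemma A_eq_sum_exp (hz : 0 < z) : 𝓜.A z = ∑ c : 𝓜.cnRep, exp (hammingNorm c.1 * log z) := by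
  simp only [A_eq_sum, exp_nat_mul, exp_log hz]

lemma deriv_A_div_mul (hz : 0 < z) : deriv 𝓜.A z / 𝓜.A z * z = 𝓜.cnMean (𝓜.cnLaw z) := by
  have hA : 𝓜.A = fun t ↦ ∑ c : 𝓜.cnRep, exp 0 * t ^ hammingNorm c.1 := by
    ext t
    simp only [A_eq_sum, exp_zero, one_mul]
  simp only [hA, deriv_div_mul_eq_mean_softmax (fun _ ↦ 0) _ hz, cnLaw, cnMean, zero_add]

lemma isCNSaddle_iff (hq : 0 < q) :
    𝓜.IsCNSaddle β z ↔ 0 < z ∧ 𝓜.cnMean (𝓜.cnLaw z) = β * (s / q) :=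
  and_congr_right fun hz ↦ by rw [𝓜.deriv_A_div_mul hz, 𝓜.intLambda_div_intRho hq]

lemma existsUnique_isCNSaddle (hq : 0 < q) (h₀ : 0 < β)
    (h₁ : β * (𝓜.intLambda / 𝓜.intRho) < 𝓜.cnMaxWeight) : ∃! z, 𝓜.IsCNSaddle β z := by
  rw [𝓜.intLambda_div_intRho hq] at h₁
  have hpos : 0 < β * (s / q) := by
    have := 𝓜.s_pos
    positivity
  obtain ⟨c, hc⟩ := 𝓜.exists_hammingNorm_eq_cnMaxWeight
  simp only [𝓜.isCNSaddle_iff hq]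
  exact existsUnique_pos_log (existsUnique_mean_softmax_eq (f := fun c : 𝓜.cnRep ↦ _)
    ⟨0, by simpa⟩ ⟨c, by simpa [hc]⟩)

/-- The CN term `Y(β)` of the growth rate: the maximal exponent, per VN, of the number of choices
of CN codewords with total weight `β`, less the exponent of the number of words of that weight on
the edges. -/
noncomputable def cnTerm (β : ℝ) : ℝ :=
  q / s * sliceSup (stdSimplex ℝ 𝓜.cnRep) 𝓜.cnMean multinomialExponent (β * (s / q)) -
    q * binEntropy (β / q)

lemma continuousOn_cnTerm (hq : 0 < q) : ContinuousOn 𝓜.cnTerm 𝓜.cnRange := by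
  have hslice := (continuousOn_sliceSup (ℓ := 𝓜.cnMean) (isCompact_stdSimplex ℝ 𝓜.cnRep)
    (convex_stdSimplex ℝ 𝓜.cnRep) continuous_multinomialExponent).comp
    (f := fun β : ℝ ↦ β * (s / q)) (by fun_prop) fun β hβ ↦ ((𝓜.mem_cnRange_iff hq).1 hβ).2
  exact (hslice.const_mul _).sub (by fun_prop)

lemma isCNTerm_cnTerm (hq : 0 < q) : 𝓜.IsCNTerm 𝓜.cnTerm := by
  refine ⟨𝓜.continuousOn_cnTerm hq, fun β hβ z hz ↦ ?_⟩
  have hβ' := ((𝓜.mem_cnRange_iff hq).1 hβ).2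
  obtain ⟨hz0, hmean⟩ := (𝓜.isCNSaddle_iff hq).1 hz
  have hmax : IsGreatest
      (multinomialExponent '' {t ∈ stdSimplex ℝ 𝓜.cnRep | 𝓜.cnMean t = β * (s / q)})
      (log (𝓜.A z) - β * (s / q) * log z) := by
    rw [𝓜.A_eq_sum_exp hz0]
    refine isGreatest_multinomialExponent_softmax _ (fun t ht ↦ ht.1) (fun t ht ↦ ?_)
      ⟨softmax_mem_stdSimplex _, hmean⟩
    simp only [← ht.2, cnMean, mean_apply, sum_mul, mul_assoc]
  have hA : 0 < 𝓜.A z := 𝓜.A_eq_sum_exp hz0 ▸ sum_exp_pos _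
  have hs := 𝓜.s_pos
  rw [cnTerm, (isGreatest_sliceSup (isCompact_stdSimplex ℝ _) continuous_multinomialExponent
    hβ').unique hmax, ← inv_div 𝓜.intLambda, 𝓜.intLambda_div_intRho hq, 𝓜.intLambda_eq hq,
    log_div (by positivity) (by positivity), log_rpow hA, log_rpow hz0, mul_one_div]
  field_simp

end CheckNode

/-! ### The growth rate -/

section GrowthRate

variable {α β : ℝ} {r : 𝓜.Letter → ℝ}

lemma mem_typePolytope_iff_exists (hq : 0 < q) : r ∈ 𝓜.typePolytope α ↔
    ∃ p ∈ inputLaws k α, ∃ t ∈ stdSimplex ℝ 𝓜.cnRep,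
      𝓜.cnMean t = 𝓜.outMean p * (s / q) ∧ r = Sum.elim p ((q / s : ℝ) • t) := by
  have hs := 𝓜.s_pos
  constructor
  · rintro ⟨⟨h₀, hvn, hcn, hedge⟩, hα⟩
    refine ⟨r ∘ .inl, ⟨⟨fun a ↦ h₀ _, hvn⟩, ?_⟩, (s / q : ℝ) • (r ∘ .inr), ⟨fun c ↦ ?_, ?_⟩, ?_, ?_⟩
    · rw [← hα, mean_apply]
      rfl
    · exact mul_nonneg (by positivity) (h₀ _)
    · simp only [Pi.smul_apply, smul_eq_mul, ← mul_sum, Function.comp_apply, hcn]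
      field_simp
    · rw [map_smul, cnMean, outMean, mean_apply, mean_apply, smul_eq_mul, mul_comm]
      exact congrArg (· * (s / q : ℝ)) hedge.symm
    · rw [smul_smul, div_mul_div_cancel₀ (by positivity), div_self (by positivity), one_smul,
        Sum.elim_comp_inl_inr]
  · rintro ⟨p, ⟨⟨hp, hp1⟩, hα⟩, t, ⟨ht, ht1⟩, hmean, rfl⟩
    refine ⟨⟨?_, hp1, ?_, ?_⟩, by rw [← hα, mean_apply]; rfl⟩
    · rintro (a | c)
      exacts [hp a, mul_nonneg (by positivity) (ht c)]
    · simp only [Sum.elim_inr, Pi.smul_apply, smul_eq_mul, ← mul_sum, ht1, mul_one]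
    · rw [outMean, cnMean, mean_apply, mean_apply] at hmean
      simp only [Sum.elim_inl, Sum.elim_inr, Pi.smul_apply, smul_eq_mul, mul_assoc, ← mul_sum,
        hmean]
      field_simp

lemma exponent_sumElim (p : (Fin k → ZMod 2) → ℝ) (t : 𝓜.cnRep → ℝ) :
    𝓜.exponent (Sum.elim p ((q / s : ℝ) • t)) =
      multinomialExponent p + (q / s * multinomialExponent t -
        q * binEntropy (𝓜.outMean p / q)) := by
  simp only [exponent, Sum.elim_inl, Sum.elim_inr, outMean, mean_apply]
  rw [multinomialExponent_smul, add_sub_assoc]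

lemma exists_exponent_le_vnTerm_add_cnTerm (h₀ : 0 < α) (h₁ : α < k) (hr : r ∈ 𝓜.typePolytope α) :
    ∃ β ∈ Set.Icc (𝓜.lower α) (𝓜.upper α) ∩ 𝓜.cnRange,
      𝓜.exponent r ≤ 𝓜.vnTerm α β + 𝓜.cnTerm β := by
  have hq := 𝓜.q_pos (Nat.cast_pos.1 (h₀.trans h₁))
  obtain ⟨p, hp, t, ht, hmean, rfl⟩ := (𝓜.mem_typePolytope_iff_exists hq).1 hr
  refine ⟨𝓜.outMean p, ⟨?_, (𝓜.mem_cnRange_iff hq).2 ⟨𝓜.outMean_pos h₀ hp, t, ht, hmean⟩⟩, ?_⟩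
  · rw [← 𝓜.image_outMean_inputLaws h₀.le h₁.le]
    exact ⟨p, hp, rfl⟩
  · rw [exponent_sumElim, vnTerm, cnTerm, ← hmean]
    gcongr
    · exact le_sliceSup isCompact_inputLaws continuous_multinomialExponent hp
    · exact le_sliceSup (isCompact_stdSimplex ℝ _) continuous_multinomialExponent ht

lemma exists_exponent_eq_vnTerm_add_cnTerm (h₀ : 0 < α) (h₁ : α < k)
    (hβ : β ∈ Set.Icc (𝓜.lower α) (𝓜.upper α) ∩ 𝓜.cnRange) :
    ∃ r ∈ 𝓜.typePolytope α, 𝓜.exponent r = 𝓜.vnTerm α β + 𝓜.cnTerm β := by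
  have hq := 𝓜.q_pos (Nat.cast_pos.1 (h₀.trans h₁))
  rw [← 𝓜.image_outMean_inputLaws h₀.le h₁.le, Set.mem_inter_iff, 𝓜.mem_cnRange_iff hq] at hβ
  obtain ⟨p, ⟨hp, hpβ⟩, hpmax⟩ :=
    (isGreatest_sliceSup isCompact_inputLaws continuous_multinomialExponent hβ.1).1
  obtain ⟨t, ⟨ht, htβ⟩, htmax⟩ := (isGreatest_sliceSup (isCompact_stdSimplex ℝ _)
    continuous_multinomialExponent hβ.2.2).1
  refine ⟨_, (𝓜.mem_typePolytope_iff_exists hq).2 ⟨p, hp, t, ht, by rw [htβ, hpβ], rfl⟩, ?_⟩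
  rw [exponent_sumElim, hpmax, htmax, hpβ, vnTerm, cnTerm]

lemma typePolytope_nonempty_iff (h₀ : 0 < α) (h₁ : α < k) : (𝓜.typePolytope α).Nonempty ↔
    (Set.Icc (𝓜.lower α) (𝓜.upper α) ∩ 𝓜.cnRange).Nonempty := by
  constructor
  · rintro ⟨r, hr⟩
    obtain ⟨β, hβ, -⟩ := 𝓜.exists_exponent_le_vnTerm_add_cnTerm h₀ h₁ hr
    exact ⟨β, hβ⟩
  · rintro ⟨β, hβ⟩
    obtain ⟨r, hr, -⟩ := 𝓜.exists_exponent_eq_vnTerm_add_cnTerm h₀ h₁ hβ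
    exact ⟨r, hr⟩

lemma isGreatest_vnTerm_add_cnTerm (h₀ : 0 < α) (h₁ : α < k) {g : ℝ}
    (hg : IsGreatest (𝓜.exponent '' 𝓜.typePolytope α) g) :
    IsGreatest ((fun β ↦ 𝓜.vnTerm α β + 𝓜.cnTerm β) ''
      (Set.Icc (𝓜.lower α) (𝓜.upper α) ∩ 𝓜.cnRange)) g := by
  obtain ⟨⟨r, hr, rfl⟩, hub⟩ := hg
  have hle : ∀ β ∈ Set.Icc (𝓜.lower α) (𝓜.upper α) ∩ 𝓜.cnRange,
      𝓜.vnTerm α β + 𝓜.cnTerm β ≤ 𝓜.exponent r := fun β hβ ↦ by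
    obtain ⟨r', hr', heq⟩ := 𝓜.exists_exponent_eq_vnTerm_add_cnTerm h₀ h₁ hβ
    exact heq ▸ hub ⟨r', hr', rfl⟩
  obtain ⟨β, hβ, hβr⟩ := 𝓜.exists_exponent_le_vnTerm_add_cnTerm h₀ h₁ hr
  exact ⟨⟨β, hβ, (hle β hβ).antisymm hβr⟩, Set.forall_mem_image.2 hle⟩

end GrowthRate

end StronglyRegularEnsemble

end DGLDPC

theorem mainTheorem3 {k q s : ℕ} (𝓜 : DGLDPC.StronglyRegularEnsemble k q s)
    (α : ℝ) (hα₀ : 0 < α) (hα₁ : α < k) :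
    (∀ β ∈ Set.Ioo (𝓜.lower α) (𝓜.upper α), ∃! p : ℝ × ℝ, 𝓜.IsVNSaddle α β p.1 p.2) ∧
    (𝓜.lower α = 𝓜.upper α → ∃ p : ℝ × ℝ, 𝓜.IsVNSaddle α (𝓜.lower α) p.1 p.2) ∧
    (∀ β : ℝ, 0 < β → β * (𝓜.intLambda / 𝓜.intRho) < 𝓜.cnMaxWeight →
      ∃! z : ℝ, 𝓜.IsCNSaddle β z) ∧
    (∃ X Y : ℝ → ℝ, 𝓜.IsVNTerm α X ∧ 𝓜.IsCNTerm Y ∧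
      ((Set.Icc (𝓜.lower α) (𝓜.upper α) ∩ 𝓜.cnRange).Nonempty →
        ∃ g : ℝ, 𝓜.HasGrowthRate α g ∧
          IsGreatest ((fun β => X β + Y β) ''
            (Set.Icc (𝓜.lower α) (𝓜.upper α) ∩ 𝓜.cnRange)) g)) ∧
    (Set.Icc (𝓜.lower α) (𝓜.upper α) ∩ 𝓜.cnRange = ∅ →
      ∀ᶠ p in 𝓜.weightFilter α, 𝓜.expNumCodewords p.1 p.2 = 0) := by
  have hq := 𝓜.q_pos (Nat.cast_pos.1 (hα₀.trans hα₁))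
  have hne := 𝓜.typePolytope_nonempty_iff hα₀ hα₁
  refine ⟨fun β ↦ 𝓜.existsUnique_isVNSaddle hα₀ hα₁,
    𝓜.exists_isVNSaddle_of_lower_eq_upper hα₀ hα₁, fun β ↦ 𝓜.existsUnique_isCNSaddle hq,
    ⟨𝓜.vnTerm α, 𝓜.cnTerm, 𝓜.isVNTerm_vnTerm hα₀.le hα₁.le, 𝓜.isCNTerm_cnTerm hq, fun h ↦ ?_⟩,
    fun h ↦ ?_⟩
  · have hg := ((𝓜.isCompact_typePolytope α).image 𝓜.continuous_exponent).isGreatest_sSup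
      ((hne.2 h).image _)
    exact ⟨_, 𝓜.hasGrowthRate_of_isGreatest hg, 𝓜.isGreatest_vnTerm_add_cnTerm hα₀ hα₁ hg⟩
  · rw [← Set.not_nonempty_iff_eq_empty, ← hne, Set.not_nonempty_iff_eq_empty] at h
    exact 𝓜.eventually_expNumCodewords_eq_zero h
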